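/- Let $m\geq 1$ and $n\geq 0$ be integers. Let $\Lambda_{2n}$ be the real Grassmann algebra with anti-commuting generators $\grave x_1,\dots,\grave x_{2n}$, with left derivatives $\partial_{\grave x_j}$, and let $\mathcal C$ be the real algebra generated by $e_1,\dots,e_m,\grave e_1,\dots,\grave e_{2n}$ with relations $e_je_k+e_ke_j=-2\delta_{jk}$, $\grave e_{2j}\grave e_{2k}-\grave e_{2k}\grave e_{2j}=0$, $\grave e_{2j-1}\grave e_{2k-1}-\grave e_{2k-1}\grave e_{2j-1}=0$, $\grave e_{2j-1}\grave e_{2k}-\grave e_{2k}\grave e_{2j-1}=\delta_{jk}$, $e_j\grave e_k+\grave e_ke_j=0$. Put $\underline{\grave x}=\sum_{j=1}^{2n}\grave x_j\grave e_j\in\Lambda_{2n}\otimes\mathcal C$. On $\mathcal D'(\mathbb R^m)\otimes\Lambda_{2n}\otimes\mathcal C$ consider the super Dirac operator $$\partial_x=2\sum_{j=1}^n\left(\grave e_{2j}\,\partial_{\grave x_{2j-1}}-\grave e_{2j-1}\,\partial_{\grave x_{2j}}\right)-\sum_{j=1}^m e_j\,\partial_{x_j},$$ the super Laplace operator $\Delta=\partial_x^2$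 (that is, $\Delta=4\sum_{j=1}^n\partial_{\grave x_{2j-1}}\partial_{\grave x_{2j}}-\sum_{j=1}^m\partial_{x_j}^2$) and the super Dirac distribution $\delta(x)=\delta(\underline x)\,\grave x_1\cdots\grave x_{2n}$, where $\delta(\underline x)$ is the Dirac distribution at the origin of $\mathbb R^m$. Let $\Delta_b=-\sum_{j=1}^m\partial_{x_j}^2$. (i) There is a sequence of locally integrable functions $\nu_{2l}^{m|0}$, $l=1,2,\dots$, on $\mathbb R^m$ such that in the sense of distributions $$\Delta_b^j\,\nu_{2l}^{m|0}=\nu_{2l-2j}^{m|0}\quad(0\le j<l),\qquad \Delta_b^l\,\nu_{2l}^{m|0}=\delta(\underline x).\qquad(*)$$ If $m$ is odd, one may take $$\nu_{2l}^{m|0}=\frac{r^{2l-m}}{\gamma_{l-1}},\qquad \gamma_l=(-1)^{l+1}(2-m)\,4^l\,l!\,\frac{\Gamma(l+2-m/2)}{\Gamma(2-m/2)}\,\frac{2\pi^{m/2}}{\Gamma(m/2)},\qquad r=|\underline x|.$$ (ii) Let $(\nu_{2l}^{m|0})_{l\ge1}$ be any sequence of locally integrable functions satisfying $(*)$. Then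 for every integer $k\ge1$ the locally integrable super function $$\nu_{2k}^{m|2n}=\sum_{l=0}^n 4^l\,\frac{(l+k-1)!}{(n-l)!\,(k-1)!}\,\nu_{2l+2k}^{m|0}\,\underline{\grave x}^{\,2n-2l}\in L_1^{\mathrm{loc}}(\mathbb R^m)\otimes\Lambda_{2n}\otimes\mathcal C$$ is a fundamental solution of $\Delta^k$: in the sense of distributions, $\Delta^k\nu_{2k}^{m|2n}=\delta(x)$. -/

import Mathlib

open MeasureTheory TopologicalSpace
open scoped TensorProduct Distributions

noncomputable section

namespace SuperSpace

/-- The bosonic space `ℝ^m`. -/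
abbrev E (m : ℕ) : Type := EuclideanSpace ℝ (Fin m)

/-! ### The algebraic part: Grassmann algebra and Clifford numbers -/

/-- For `j = 0, …, n - 1`, the position of the fermionic generator with (one-based) index
`2 (j + 1) - 1` among the `2 n` fermionic generators. -/
def oddIdx {n : ℕ} (j : Fin n) : Fin (2 * n) := ⟨2 * j.1, by omega⟩

/-- For `j = 0, …, n - 1`, the position of the fermionic generator with (one-based) index
`2 (j + 1)` among the `2 n` fermionic generators. -/
def evenIdx {n : ℕ} (j : Fin n) : Fin (2 * n) := ⟨2 * j.1 + 1, by omega⟩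

/-- The Grassmann algebra `Λ_{2n}` on `2 n` anti-commuting generators. -/
abbrev Grassmann (n : ℕ) : Type := ExteriorAlgebra ℝ (Fin (2 * n) → ℝ)

/-- The anti-commuting variables. -/
def gvar {n : ℕ} (j : Fin (2 * n)) : Grassmann n := ExteriorAlgebra.ι ℝ (Pi.single j 1)

/-- The (left) partial derivative with respect to an anti-commuting variable: the unique linear map
that kills `1` and satisfies `∂_j (v * a) = v_j a - v * ∂_j a` for `v` of degree one. -/
def gderiv {n : ℕ} (j : Fin (2 * n)) : Module.End ℝ (Grassmann n) :=
  CliffordAlgebra.contractLeft (LinearMap.proj j)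

/-- The defining relations between the `m` orthogonal Clifford generators (`Sum.inl`) and the
`2 n` symplectic Clifford generators (`Sum.inr`). -/
inductive CliffordRel (m n : ℕ) :
    FreeAlgebra ℝ (Fin m ⊕ Fin (2 * n)) → FreeAlgebra ℝ (Fin m ⊕ Fin (2 * n)) → Prop
  | orth (i j : Fin m) : CliffordRel m n
      (FreeAlgebra.ι ℝ (Sum.inl i) * FreeAlgebra.ι ℝ (Sum.inl j)
        + FreeAlgebra.ι ℝ (Sum.inl j) * FreeAlgebra.ι ℝ (Sum.inl i))
      (algebraMap ℝ _ (if i = j then -2 else 0))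
  | even_even (j k : Fin n) : CliffordRel m n
      (FreeAlgebra.ι ℝ (Sum.inr (evenIdx j)) * FreeAlgebra.ι ℝ (Sum.inr (evenIdx k))
        - FreeAlgebra.ι ℝ (Sum.inr (evenIdx k)) * FreeAlgebra.ι ℝ (Sum.inr (evenIdx j)))
      0
  | odd_odd (j k : Fin n) : CliffordRel m n
      (FreeAlgebra.ι ℝ (Sum.inr (oddIdx j)) * FreeAlgebra.ι ℝ (Sum.inr (oddIdx k))
        - FreeAlgebra.ι ℝ (Sum.inr (oddIdx k)) * FreeAlgebra.ι ℝ (Sum.inr (oddIdx j)))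
      0
  | odd_even (j k : Fin n) : CliffordRel m n
      (FreeAlgebra.ι ℝ (Sum.inr (oddIdx j)) * FreeAlgebra.ι ℝ (Sum.inr (evenIdx k))
        - FreeAlgebra.ι ℝ (Sum.inr (evenIdx k)) * FreeAlgebra.ι ℝ (Sum.inr (oddIdx j)))
      (algebraMap ℝ _ (if j = k then 1 else 0))
  | mixed (i : Fin m) (j : Fin (2 * n)) : CliffordRel m n
      (FreeAlgebra.ι ℝ (Sum.inl i) * FreeAlgebra.ι ℝ (Sum.inr j)
        + FreeAlgebra.ι ℝ (Sum.inr j) * FreeAlgebra.ι ℝ (Sum.inl i))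
      0

/-- The algebra `𝒞` generated by the orthogonal and the symplectic Clifford generators. -/
def Clifford (m n : ℕ) : Type := RingQuot (CliffordRel m n)

instance (m n : ℕ) : Ring (Clifford m n) := inferInstanceAs (Ring (RingQuot (CliffordRel m n)))

instance (m n : ℕ) : Algebra ℝ (Clifford m n) :=
  inferInstanceAs (Algebra ℝ (RingQuot (CliffordRel m n)))

/-- The quotient map from the free algebra on the generators. -/
def Clifford.mk (m n : ℕ) : FreeAlgebra ℝ (Fin m ⊕ Fin (2 * n)) →ₐ[ℝ] Clifford m n :=
  RingQuot.mkAlgHom ℝ (CliffordRel m n)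

/-- The orthogonal Clifford generators. -/
def oGen {m n : ℕ} (i : Fin m) : Clifford m n :=
  Clifford.mk m n (FreeAlgebra.ι ℝ (Sum.inl i))

/-- The symplectic Clifford generators. -/
def sGen {m n : ℕ} (j : Fin (2 * n)) : Clifford m n :=
  Clifford.mk m n (FreeAlgebra.ι ℝ (Sum.inr j))

/-- `Λ_{2n} ⊗ 𝒞`; the Grassmann variables commute with the Clifford numbers. -/
abbrev GC (m n : ℕ) : Type := Grassmann n ⊗[ℝ] Clifford m n

/-- The fermionic vector variable: the sum of the anti-commuting variables multiplied by the
symplectic Clifford generators. -/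
def fermVec (m n : ℕ) : GC m n := ∑ j : Fin (2 * n), gvar j ⊗ₜ[ℝ] sGen j

/-! ### Functions and distributions -/

/-- Locally integrable real functions on `ℝ^m`. -/
def L1loc (m : ℕ) : Submodule ℝ (E m → ℝ) where
  carrier := {f | LocallyIntegrable f volume}
  add_mem' hf hg := hf.add hg
  zero_mem' := locallyIntegrable_zero
  smul_mem' c _ hf := hf.smul c

/-- Distributions on `ℝ^m`. -/
abbrev Distr (m : ℕ) : Type := 𝓓'((⊤ : Opens (E m)), ℝ)

/-- The regular distribution `φ ↦ ∫ φ f` given by a locally integrable function `f`. -/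
def toDistr (m : ℕ) : L1loc m →ₗ[ℝ] Distr m where
  toFun f := TestFunction.integralAgainstBilinCLM (ContinuousLinearMap.mul ℝ ℝ) volume (f : E m → ℝ)
  map_add' f g := by
    ext φ
    have hf : LocallyIntegrableOn (f : E m → ℝ) ((⊤ : Opens (E m)) : Set (E m)) volume :=
      f.2.locallyIntegrableOn _
    have hg : LocallyIntegrableOn (g : E m → ℝ) ((⊤ : Opens (E m)) : Set (E m)) volume :=
      g.2.locallyIntegrableOn _
    have h := integral_add (φ.integrable_bilin (ContinuousLinearMap.mul ℝ ℝ) hf)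
      (φ.integrable_bilin (ContinuousLinearMap.mul ℝ ℝ) hg)
    change TestFunction.integralAgainstBilinCLM (ContinuousLinearMap.mul ℝ ℝ) volume
        ((f + g : L1loc m) : E m → ℝ) φ
      = TestFunction.integralAgainstBilinCLM (ContinuousLinearMap.mul ℝ ℝ) volume
          (f : E m → ℝ) φ
        + TestFunction.integralAgainstBilinCLM (ContinuousLinearMap.mul ℝ ℝ) volume
          (g : E m → ℝ) φ
    rw [TestFunction.integralAgainstBilinCLM_eq_integral hf,
      TestFunction.integralAgainstBilinCLM_eq_integral hg,
      TestFunction.integralAgainstBilinCLM_eq_integral ((f + g).2.locallyIntegrableOn _), ← h]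
    simp [mul_add]
  map_smul' c f := by
    ext φ
    change TestFunction.integralAgainstBilinCLM (ContinuousLinearMap.mul ℝ ℝ) volume
        ((c • f : L1loc m) : E m → ℝ) φ
      = c • TestFunction.integralAgainstBilinCLM (ContinuousLinearMap.mul ℝ ℝ) volume
          (f : E m → ℝ) φ
    rw [TestFunction.integralAgainstBilinCLM_eq_integral (f.2.locallyIntegrableOn _),
      TestFunction.integralAgainstBilinCLM_eq_integral ((c • f).2.locallyIntegrableOn _),
      ← integral_smul]
    refine integral_congr_ae (Filter.Eventually.of_forall fun x => ?_)
    simp [mul_left_comm]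

/-- The distributional partial derivative `∂_{x_i}`. -/
def bderiv {m : ℕ} (i : Fin m) : Module.End ℝ (Distr m) :=
  (Distribution.lineDerivCLM (EuclideanSpace.single i (1 : ℝ)) : Distr m →L[ℝ] Distr m).toLinearMap

/-- The bosonic Laplace operator `Δ_b = - ∑ ∂_{x_i}^2` on distributions. -/
def bLaplace (m : ℕ) : Module.End ℝ (Distr m) := - ∑ i : Fin m, bderiv i * bderiv i

/-- `ν l` stands for `ν_{2l}^{m|0}`, `l = 1, 2, …` (the entry `ν 0` is not used):
a sequence of functions with `Δ_b^j ν_{2l} = ν_{2l-2j}` for `j < l` and `Δ_b^l ν_{2l} = δ`. -/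
def IsPolyharmonicSequence {m : ℕ} (ν : ℕ → L1loc m) : Prop :=
  ∀ l : ℕ, 1 ≤ l →
    (∀ j : ℕ, j < l → (bLaplace m ^ j) (toDistr m (ν l)) = toDistr m (ν (l - j))) ∧
    (bLaplace m ^ l) (toDistr m (ν l)) = Distribution.delta 0

/-- The constants `γ_l` in the explicit polyharmonic fundamental solutions in odd dimension. -/
def gammaConst (m l : ℕ) : ℝ :=
  (-1) ^ (l + 1) * (2 - m) * 4 ^ l * l.factorial
    * (Real.Gamma (l + 2 - m / 2) / Real.Gamma (2 - m / 2))
    * (2 * Real.pi ^ ((m : ℝ) / 2) / Real.Gamma (m / 2))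

/-! ### Super functions, super distributions and their operators -/

/-- Locally integrable super functions, `L_1^loc(ℝ^m) ⊗ Λ_{2n} ⊗ 𝒞`. -/
abbrev SuperL1loc (m n : ℕ) : Type := L1loc m ⊗[ℝ] GC m n

/-- Super distributions, `𝓓'(ℝ^m) ⊗ Λ_{2n} ⊗ 𝒞`. -/
abbrev SuperDistr (m n : ℕ) : Type := Distr m ⊗[ℝ] GC m n

/-- The super distribution given by a locally integrable super function. -/
def toSuperDistr (m n : ℕ) : SuperL1loc m n →ₗ[ℝ] SuperDistr m n :=
  TensorProduct.map (toDistr m) LinearMap.id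

/-- The super Dirac operator
`∂_x = 2 ∑_j (è_{2j} ∂_{x̀_{2j-1}} - è_{2j-1} ∂_{x̀_{2j}}) - ∑_i e_i ∂_{x_i}`. -/
def superDirac (m n : ℕ) : Module.End ℝ (SuperDistr m n) :=
  (2 : ℝ) • ∑ j : Fin n,
      (TensorProduct.map LinearMap.id
          (TensorProduct.map (gderiv (oddIdx j)) (LinearMap.mulLeft ℝ (sGen (evenIdx j))))
        - TensorProduct.map LinearMap.id
          (TensorProduct.map (gderiv (evenIdx j)) (LinearMap.mulLeft ℝ (sGen (oddIdx j)))))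
    - ∑ i : Fin m, TensorProduct.map (bderiv i)
        (TensorProduct.map LinearMap.id (LinearMap.mulLeft ℝ (oGen i)))

/-- The super Laplace operator `Δ = ∂_x^2`. -/
def superLaplace (m n : ℕ) : Module.End ℝ (SuperDistr m n) := superDirac m n ^ 2

/-- The super Dirac distribution `δ(x) x̀_1 ⋯ x̀_{2n}`. -/
def superDelta (m n : ℕ) : SuperDistr m n :=
  (Distribution.delta 0 : Distr m) ⊗ₜ[ℝ] ((List.ofFn (gvar (n := n))).prod ⊗ₜ[ℝ] (1 : Clifford m n))

/-- The super function `ν_{2k}^{m|2n}` built from a sequence `ν l = ν_{2l}^{m|0}`. -/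
def superNu {m : ℕ} (n : ℕ) (ν : ℕ → L1loc m) (k : ℕ) : SuperL1loc m n :=
  ∑ l ∈ Finset.range (n + 1),
    ((4 : ℝ) ^ l * ((l + k - 1).factorial : ℝ) / (((n - l).factorial : ℝ) * ((k - 1).factorial : ℝ)))
      • (ν (l + k) ⊗ₜ[ℝ] (fermVec m n ^ (2 * n - 2 * l)))

end SuperSpace

end

open SuperSpace

open SuperSpace

/-! ### Generalities -/

/-! Fermionic side. Write θ = `gquad n` for the sum of the products of conjugate anticommuting
variables. The relations in `𝒞` give `fermVec ^ 2 = θ ⊗ 1` and turn the square of the Dirac operator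
into `Δ_b + 4 L` with L = `gLap n` (`fermVec_mul_self`, `superLaplace_eq`). The commutator of L with
multiplication by θ is the Euler operator minus n, an sl₂ relation, whence L θ^(s+1) = -(s+1)(n-s)
θ^s; moreover θ^n is n! times the product of all variables. Applying Δ to `superNu n ν k`, each
power θ^(n-l-1) receives a bosonic term from index l+1 and a fermionic one from index l, both
carrying ν_{2l+2k}. The coefficients are such that for k > 1 these add up to the coefficient for
k-1, while for k = 1 they cancel and only Δ_b ν_2 ⊗ θ^n / n! = δ(x) survives. Induction on k
finishes part (ii).

Bosonic side. The functions w^a (A + B log w) of w = ‖x‖² are closed under Δ_b. Replacing w by ‖x‖²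
+ ε makes them smooth, so integration by parts is legitimate; it produces the classical Laplacian
plus an error of the form ε w^(a-2) (A₂ + B₂ log w). As ε → 0 the error disappears by dominated
convergence when a - 1 > -m/2 (`bLaplace_radial`); when a = 1 - m/2 the classical term is zero and
the error is an approximate identity (`bLaplace_radial_eq_delta`). Solving the recursion for A and B
gives the sequence ν; a logarithm is needed only from the index where the exponent becomes 0, which
never happens for m odd, and there the coefficients are 1/γ_l. -/

theorem two_smul_sum_mul_sum {ι R : Type*} [Ring R] (s : Finset ι) (A : ι → R) :
    2 * ((∑ j ∈ s, A j) * ∑ j ∈ s, A j) = ∑ j ∈ s, ∑ k ∈ s, (A j * A k + A k * A j) := by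
  simp_rw [Finset.sum_add_distrib]
  rw [Finset.sum_comm (f := fun j k => A k * A j), Finset.sum_mul_sum, two_mul]

/-- The square of a sum of pairwise anticommuting elements of an `ℝ`-algebra. -/
theorem sum_mul_sum_of_anticomm {ι R : Type*} [Fintype ι] [DecidableEq ι] [Ring R] [Algebra ℝ R]
    (A Y : ι → R) (h : ∀ j k, A j * A k + A k * A j = if j = k then (2 : ℝ) • Y j else 0) :
    (∑ j, A j) * ∑ j, A j = ∑ j, Y j := by
  have h2 := two_smul_sum_mul_sum Finset.univ A
  simp_rw [h] at h2
  simp only [Finset.sum_ite_eq, Finset.mem_univ, if_true, ← Finset.smul_sum] at h2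
  rw [two_mul, ← two_smul ℝ] at h2
  exact smul_right_injective R (two_ne_zero' ℝ) h2

/-- Common core of two computations: the square of the fermionic vector variable and that of the
fermionic part of the Dirac operator. -/
theorem sum_add_sq_of_anticomm {ι R : Type*} [Fintype ι] [DecidableEq ι] [Ring R] [Algebra ℝ R]
    (P Q Z : ι → R) (hP : ∀ j k, P j * P k + P k * P j = 0)
    (hQ : ∀ j k, Q j * Q k + Q k * Q j = 0)
    (hPQ : ∀ j k, P j * Q k + Q k * P j = if j = k then Z j else 0) :
    (∑ j, (P j + Q j)) * ∑ j, (P j + Q j) = ∑ j, Z j := by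
  have h1 : (∑ j, P j) * ∑ j, P j = ∑ j : ι, (0 : R) :=
    sum_mul_sum_of_anticomm P 0 fun j k => by simp [hP]
  have h2 : (∑ j, Q j) * ∑ j, Q j = ∑ j : ι, (0 : R) :=
    sum_mul_sum_of_anticomm Q 0 fun j k => by simp [hQ]
  have h3 : (∑ j, P j) * (∑ j, Q j) + (∑ j, Q j) * (∑ j, P j) = ∑ j, Z j := by
    rw [Finset.sum_mul_sum, Finset.sum_mul_sum, Finset.sum_comm (f := fun j k => Q j * P k)]
    simp_rw [← Finset.sum_add_distrib, hPQ]
    simp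
  simp only [Finset.sum_const_zero] at h1 h2
  rw [Finset.sum_add_distrib, add_mul, mul_add, mul_add, h1, h2, ← h3]
  abel

theorem List.prod_ofFn_two_mul {M : Type*} [Monoid M] {n : ℕ} (f : Fin (2 * n) → M) :
    (List.ofFn f).prod = (List.ofFn fun j : Fin n => f (oddIdx j) * f (evenIdx j)).prod := by
  rw [List.ofFn_mul', List.prod_flatten, List.map_ofFn]
  congr 2
  funext j
  simp [oddIdx, evenIdx]

theorem Fin.sum_univ_two_mul {M : Type*} [AddCommMonoid M] {n : ℕ} (f : Fin (2 * n) → M) :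
    ∑ i, f i = ∑ j : Fin n, (f (oddIdx j) + f (evenIdx j)) := by
  have := List.prod_ofFn_two_mul (M := Multiplicative M) (fun i => Multiplicative.ofAdd (f i))
  rw [List.prod_ofFn, List.prod_ofFn] at this
  -- Products in `Multiplicative M` unfold definitionally to sums in `M`.
  exact this

theorem add_pow_succ_of_sq_eq_zero {R : Type*} [Ring R] {t S : R} (ht : t * t = 0)
    (h : Commute t S) (k : ℕ) :
    (t + S) ^ (k + 1) = S ^ (k + 1) + (k + 1 : ℕ) • (t * S ^ k) := by
  induction k with
  | zero => simp [add_comm]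
  | succ k ih =>
    rw [pow_succ' _ (k + 1), ih, add_mul, mul_add, mul_add, mul_smul_comm, mul_smul_comm,
      ← mul_assoc t t, ht, ← mul_assoc S t, ← h.eq, mul_assoc t S, ← pow_succ', ← pow_succ',
      zero_mul, smul_zero, succ_nsmul _ (k + 1)]
    abel

/-- In the multinomial expansion only the square-free monomials survive. The vanishing of the next
power is carried along because it kills the term S^(k+1) in `add_pow_succ_of_sq_eq_zero`. -/
theorem List.sum_pow_length_of_commute {R : Type*} [Ring R] (L : List R)
    (hsq : ∀ t ∈ L, t * t = 0) (hc : ∀ s ∈ L, ∀ t ∈ L, Commute s t) :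
    L.sum ^ L.length = L.length.factorial • L.prod ∧ L.sum ^ (L.length + 1) = 0 := by
  induction L with
  | nil => simp
  | cons t L ih =>
    obtain ⟨h1, h2⟩ := ih (fun s hs => hsq s (by simp [hs]))
      (fun s hs u hu => hc s (by simp [hs]) u (by simp [hu]))
    have ht : t * t = 0 := hsq t (by simp)
    have hS : Commute t L.sum := Commute.list_sum_right _ _ fun u hu => hc t (by simp) u (by simp [hu])
    simp only [List.sum_cons, List.length_cons, List.prod_cons]
    rw [add_pow_succ_of_sq_eq_zero ht hS, add_pow_succ_of_sq_eq_zero ht hS, pow_succ _ (_ + 1), h2, h1]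
    rw [zero_mul, zero_add, Nat.factorial_succ, mul_smul, mul_smul_comm]
    simp

/-! ### The Grassmann algebra -/

section Grassmann

variable {n : ℕ}

theorem gvar_mul_gvar_add (i j : Fin (2 * n)) : gvar i * gvar j + gvar j * gvar i = 0 := by
  exact ExteriorAlgebra.ι_add_mul_swap _ _

theorem gvar_mul_self (i : Fin (2 * n)) : gvar i * gvar i = 0 := by
  simp [gvar]

theorem gderiv_gvar_mul (i j : Fin (2 * n)) (a : Grassmann n) :
    gderiv i (gvar j * a) = (if i = j then a else 0) - gvar j * gderiv i a := by
  rw [gderiv, gvar, ExteriorAlgebra.ι, CliffordAlgebra.contractLeft_ι_mul]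
  simp [Pi.single_apply]

theorem gderiv_one (i : Fin (2 * n)) : gderiv i (1 : Grassmann n) = 0 :=
  CliffordAlgebra.contractLeft_one _ _

theorem gderiv_mul_gderiv_add (i j : Fin (2 * n)) :
    gderiv i * gderiv j + gderiv j * gderiv i = 0 := by
  refine LinearMap.ext fun a => ?_
  have := CliffordAlgebra.contractLeft_comm (Q := (0 : QuadraticForm ℝ (Fin (2 * n) → ℝ)))
    (LinearMap.proj i) (LinearMap.proj j) a
  simp only [LinearMap.add_apply, Module.End.mul_apply, gderiv, LinearMap.zero_apply]
  rw [this]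
  exact neg_add_cancel _

theorem oddIdx_inj {j k : Fin n} : oddIdx j = oddIdx k ↔ j = k := by
  simp [oddIdx, Fin.ext_iff]

theorem evenIdx_inj {j k : Fin n} : evenIdx j = evenIdx k ↔ j = k := by
  simp [evenIdx, Fin.ext_iff]

theorem oddIdx_ne_evenIdx (j k : Fin n) : oddIdx j ≠ evenIdx k := by
  simp only [oddIdx, evenIdx, ne_eq, Fin.ext_iff]; omega

/-- The product of two conjugate anticommuting variables. -/
noncomputable def gpair (j : Fin n) : Grassmann n := gvar (oddIdx j) * gvar (evenIdx j)

/-- The scalar part of the square of the fermionic vector variable. -/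
noncomputable def gquad (n : ℕ) : Grassmann n := ∑ j, gpair j

/-- A quarter of the fermionic Laplace operator. -/
noncomputable def gLap (n : ℕ) : Module.End ℝ (Grassmann n) :=
  ∑ j : Fin n, gderiv (oddIdx j) * gderiv (evenIdx j)

/-- The fermionic Euler operator. -/
noncomputable def gEuler (n : ℕ) : Module.End ℝ (Grassmann n) :=
  ∑ j : Fin n, (LinearMap.mulLeft ℝ (gvar (oddIdx j)) * gderiv (oddIdx j)
    + LinearMap.mulLeft ℝ (gvar (evenIdx j)) * gderiv (evenIdx j))

theorem gvar_mul_gvar_comm (i j : Fin (2 * n)) : gvar i * gvar j = -(gvar j * gvar i) :=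
  eq_neg_of_add_eq_zero_left (gvar_mul_gvar_add i j)

theorem gvar_commute_gpair (i : Fin (2 * n)) (j : Fin n) : Commute (gvar i) (gpair j) := by
  rw [Commute, SemiconjBy, gpair, ← mul_assoc, gvar_mul_gvar_comm i, neg_mul, mul_assoc,
    gvar_mul_gvar_comm i, mul_neg, neg_neg, mul_assoc]

theorem gvar_commute_gquad (i : Fin (2 * n)) : Commute (gvar i) (gquad n) :=
  Commute.sum_right _ _ _ fun j _ => gvar_commute_gpair i j

theorem gpair_commute (i j : Fin n) : Commute (gpair i) (gpair j) :=
  (gvar_commute_gpair _ j).mul_left (gvar_commute_gpair _ j)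

theorem gpair_mul_self (j : Fin n) : gpair j * gpair j = 0 := by
  conv_lhs => enter [1]; rw [gpair]
  rw [mul_assoc, (gvar_commute_gpair _ j).eq, gpair, mul_assoc (gvar (oddIdx j)), gvar_mul_self,
    mul_zero, mul_zero]

theorem gderiv_odd_gquad_mul (j : Fin n) (a : Grassmann n) :
    gderiv (oddIdx j) (gquad n * a) = gvar (evenIdx j) * a + gquad n * gderiv (oddIdx j) a := by
  rw [gquad, Finset.sum_mul, map_sum]
  simp only [gpair, mul_assoc, gderiv_gvar_mul, oddIdx_inj, oddIdx_ne_evenIdx, if_false, zero_sub,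
    mul_neg, sub_neg_eq_add, Finset.sum_add_distrib, Finset.sum_ite_eq, Finset.mem_univ, if_true,
    Finset.sum_mul]

theorem gderiv_even_gquad_mul (j : Fin n) (a : Grassmann n) :
    gderiv (evenIdx j) (gquad n * a) = -(gvar (oddIdx j) * a) + gquad n * gderiv (evenIdx j) a := by
  rw [gquad, Finset.sum_mul, map_sum]
  simp only [gpair, mul_assoc, gderiv_gvar_mul, evenIdx_inj, (oddIdx_ne_evenIdx _ _).symm, if_false,
    zero_sub, mul_sub, neg_sub, Finset.sum_sub_distrib, mul_ite, mul_zero, Finset.sum_ite_eq,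
    Finset.mem_univ, if_true, Finset.sum_mul]
  abel

/-- The sl₂ relation: the two derivatives of the j-th pair hit the j-th summand of θ either
separately, giving the Euler terms, or both, giving -1; summing the latter over j yields -n. -/
theorem gLap_gquad_mul (a : Grassmann n) :
    gLap n (gquad n * a) = gquad n * gLap n a + gEuler n a - (n : ℝ) • a := by
  simp only [gLap, gEuler, LinearMap.sum_apply, Module.End.mul_apply, gderiv_even_gquad_mul, map_add,
    map_neg, gderiv_gvar_mul, if_true, gderiv_odd_gquad_mul, LinearMap.add_apply,
    LinearMap.mulLeft_apply, neg_sub, Finset.mul_sum]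
  rw [← Finset.sum_add_distrib]
  have : (n : ℝ) • a = ∑ _j : Fin n, a := by simp [Nat.cast_smul_eq_nsmul]
  rw [this, ← Finset.sum_sub_distrib]
  exact Finset.sum_congr rfl fun j _ => by abel

theorem gEuler_gquad_mul (a : Grassmann n) :
    gEuler n (gquad n * a) = (2 : ℝ) • (gquad n * a) + gquad n * gEuler n a := by
  have h (j : Fin n) : gvar (evenIdx j) * (gvar (oddIdx j) * a) = -(gpair j * a) := by
    rw [← mul_assoc, gvar_mul_gvar_comm, neg_mul, gpair]
  have h' (j : Fin n) : gvar (oddIdx j) * (gvar (evenIdx j) * a) = gpair j * a := by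
    rw [← mul_assoc, gpair]
  have hc (i : Fin (2 * n)) (b : Grassmann n) : gvar i * (gquad n * b) = gquad n * (gvar i * b) := by
    rw [← mul_assoc, (gvar_commute_gquad i).eq, mul_assoc]
  simp only [gEuler, LinearMap.sum_apply, Module.End.mul_apply, gderiv_even_gquad_mul,
    gderiv_odd_gquad_mul, LinearMap.add_apply, LinearMap.mulLeft_apply, mul_add, mul_neg, h, h', hc,
    neg_neg, Finset.sum_add_distrib, two_smul, ← Finset.sum_mul, ← gquad.eq_1, Finset.mul_sum]
  abel

theorem gEuler_one : gEuler n 1 = 0 := by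
  simp [gEuler, gderiv_one]

theorem gLap_one : gLap n 1 = 0 := by
  simp [gLap, gderiv_one]

theorem gEuler_gquad_pow (s : ℕ) : gEuler n (gquad n ^ s) = (2 * s : ℝ) • gquad n ^ s := by
  induction s with
  | zero => simp [gEuler_one]
  | succ s ih =>
    rw [pow_succ', gEuler_gquad_mul, ih, mul_smul_comm, ← add_smul]
    congr 1
    push_cast
    ring

/-- Moving `gLap` through the factors one at a time, the commutator acts on θ^i by 2i - n; summing
over i ≤ s gives (s+1)(s-n). -/
theorem gLap_gquad_pow_succ (s : ℕ) :
    gLap n (gquad n ^ (s + 1)) = (-((s + 1) * (n - s)) : ℝ) • gquad n ^ s := by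
  induction s with
  | zero => rw [pow_succ', gLap_gquad_mul]; simp [gLap_one, gEuler_one]
  | succ s ih =>
    rw [pow_succ', gLap_gquad_mul, ih, mul_smul_comm, ← pow_succ', gEuler_gquad_pow, ← add_smul,
      ← sub_smul]
    congr 1
    push_cast
    ring

theorem gquad_pow_self :
    gquad n ^ n = (n.factorial : ℝ) • (List.ofFn (gvar (n := n))).prod := by
  have h := (List.sum_pow_length_of_commute (List.ofFn (gpair (n := n))) (by simp [gpair_mul_self])
    (by simp [gpair_commute])).1
  rw [List.sum_ofFn, List.length_ofFn] at h
  rw [gquad, h, List.prod_ofFn_two_mul, Nat.cast_smul_eq_nsmul]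
  rfl

end Grassmann

/-- Abstract form of squaring the Dirac operator: P - Q is the fermionic part, X the bosonic part,
and the two anticommute, so the cross terms drop out. -/
theorem sq_smul_sum_sub_of_anticomm {I J R : Type*} [Fintype I] [DecidableEq I] [Fintype J]
    [DecidableEq J] [Ring R] [Algebra ℝ R] (P Q : J → R) (X : I → R) (Z : J → R) (Y : I → R)
    (hP : ∀ j k, P j * P k + P k * P j = 0) (hQ : ∀ j k, Q j * Q k + Q k * Q j = 0)
    (hPQ : ∀ j k, P j * Q k + Q k * P j = if j = k then (-1 : ℝ) • Z j else 0)
    (hXP : ∀ i j, X i * P j + P j * X i = 0) (hXQ : ∀ i j, X i * Q j + Q j * X i = 0)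
    (hX : ∀ i j, X i * X j + X j * X i = if i = j then (-2 : ℝ) • Y i else 0) :
    ((2 : ℝ) • ∑ j, (P j - Q j) - ∑ i, X i) ^ 2 = (4 : ℝ) • ∑ j, Z j + (-1 : ℝ) • ∑ i, Y i := by
  have hF : (∑ j, (P j - Q j)) * ∑ j, (P j - Q j) = ∑ j, Z j := by
    simp only [sub_eq_add_neg]
    refine sum_add_sq_of_anticomm _ _ _ hP (fun j k => ?_) (fun j k => ?_)
    · rw [neg_mul_neg, neg_mul_neg, hQ]
    · rw [mul_neg, neg_mul, ← neg_add, hPQ]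
      split_ifs <;> simp
  have hB := sum_mul_sum_of_anticomm X (fun i => (-1 : ℝ) • Y i) fun i j => by
    rw [hX, smul_smul]; norm_num
  have hFX : (∑ i, X i) * (∑ j, (P j - Q j)) = -((∑ j, (P j - Q j)) * ∑ i, X i) := by
    refine eq_neg_of_add_eq_zero_left ?_
    rw [Finset.sum_mul_sum, Finset.sum_mul_sum, Finset.sum_comm, ← Finset.sum_add_distrib]
    refine Finset.sum_eq_zero fun j _ => ?_
    rw [← Finset.sum_add_distrib]
    refine Finset.sum_eq_zero fun i _ => ?_
    rw [mul_sub, sub_mul, sub_add_sub_comm, hXP, hXQ, sub_zero]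
  rw [pow_two, sub_mul, mul_sub, mul_sub, smul_mul_smul_comm, smul_mul_assoc, mul_smul_comm, hF, hB,
    hFX, smul_neg, ← Finset.smul_sum]
  norm_num [sub_eq_add_neg]
  abel

/-! ### Factorwise operators on threefold tensor products -/

section TensorOp

variable {V G C : Type*} [AddCommGroup V] [Module ℝ V] [AddCommGroup G] [Module ℝ G]
  [Ring C] [Algebra ℝ C]

/-- The operator on a threefold tensor product acting factorwise, by a left multiplication on the
last factor. -/
noncomputable def tensorOp (D : Module.End ℝ V) (P : Module.End ℝ G)
    (c : C) : Module.End ℝ (V ⊗[ℝ] (G ⊗[ℝ] C)) :=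
  TensorProduct.map D (TensorProduct.map P (LinearMap.mulLeft ℝ c))

theorem tensorOp_mul (D D' : Module.End ℝ V) (P P' : Module.End ℝ G)
    (c c' : C) :
    tensorOp D P c * tensorOp D' P' c' = tensorOp (D * D') (P * P') (c * c') := by
  simp only [tensorOp, ← TensorProduct.map_mul, LinearMap.mulLeft_mul]
  rfl

theorem tensorOp_tmul (D : Module.End ℝ V) (P : Module.End ℝ G)
    (c : C) (f : V) (a : G) (b : C) :
    tensorOp D P c (f ⊗ₜ (a ⊗ₜ b)) = D f ⊗ₜ (P a ⊗ₜ (c * b)) := rfl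

theorem mulLeft_add' (c c' : C) :
    LinearMap.mulLeft ℝ (c + c') = LinearMap.mulLeft ℝ c + LinearMap.mulLeft ℝ c' :=
  LinearMap.ext fun _ => add_mul _ _ _

theorem tensorOp_add_clifford (D : Module.End ℝ V) (P : Module.End ℝ G)
    (c c' : C) : tensorOp D P c + tensorOp D P c' = tensorOp D P (c + c') := by
  simp only [tensorOp, mulLeft_add', TensorProduct.map_add_right]

theorem tensorOp_smul_clifford (D : Module.End ℝ V) (P : Module.End ℝ G)
    (r : ℝ) (c : C) : tensorOp D P (r • c) = r • tensorOp D P c := by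
  have : LinearMap.mulLeft ℝ (r • c) = r • LinearMap.mulLeft ℝ c :=
    LinearMap.ext fun _ => smul_mul_assoc _ _ _
  simp only [tensorOp, this, TensorProduct.map_smul_right]

theorem tensorOp_zero_clifford (D : Module.End ℝ V) (P : Module.End ℝ G) :
    tensorOp D P (0 : C) = 0 := by
  simpa using tensorOp_smul_clifford D P 0 (0 : C)

theorem tensorOp_add_grassmann (D : Module.End ℝ V) (P P' : Module.End ℝ G)
    (c : C) : tensorOp D P c + tensorOp D P' c = tensorOp D (P + P') c := by
  simp only [tensorOp, TensorProduct.map_add_left, TensorProduct.map_add_right]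

theorem tensorOp_smul_grassmann (D : Module.End ℝ V) (P : Module.End ℝ G)
    (r : ℝ) (c : C) : tensorOp D (r • P) c = r • tensorOp D P c := by
  simp only [tensorOp, TensorProduct.map_smul_left, TensorProduct.map_smul_right]

theorem tensorOp_zero_grassmann (D : Module.End ℝ V) (c : C) :
    tensorOp D (0 : Module.End ℝ G) c = 0 := by
  simpa using tensorOp_smul_grassmann D (0 : Module.End ℝ G) 0 c

theorem tensorOp_sum_grassmann {ι : Type*} (s : Finset ι) (D : Module.End ℝ V)
    (P : ι → Module.End ℝ G) (c : C) :
    ∑ j ∈ s, tensorOp D (P j) c = tensorOp D (∑ j ∈ s, P j) c :=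
  (map_sum (AddMonoidHom.mk' (fun P => tensorOp D P c)
    fun P P' => (tensorOp_add_grassmann D P P' c).symm) P s).symm

theorem tensorOp_add_distr (D D' : Module.End ℝ V) (P : Module.End ℝ G)
    (c : C) : tensorOp D P c + tensorOp D' P c = tensorOp (D + D') P c := by
  simp only [tensorOp, TensorProduct.map_add_left]

theorem tensorOp_sum_distr {ι : Type*} (s : Finset ι) (D : ι → Module.End ℝ V)
    (P : Module.End ℝ G) (c : C) :
    ∑ j ∈ s, tensorOp (D j) P c = tensorOp (∑ j ∈ s, D j) P c :=
  (map_sum (AddMonoidHom.mk' (fun D => tensorOp D P c)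
    fun D D' => (tensorOp_add_distr D D' P c).symm) D s).symm

theorem tensorOp_smul_distr (D : Module.End ℝ V) (P : Module.End ℝ G) (r : ℝ) (c : C) :
    tensorOp (r • D) P c = r • tensorOp D P c := by
  simp only [tensorOp, TensorProduct.map_smul_left]

/-- Anticommuting derivatives paired with commuting generators make the `p`-`p` and `q`-`q`
anticommutators vanish. In the mixed one the sign of the derivatives turns the anticommutator of
generators into a commutator, which is a scalar. For the bosonic terms the roles are exchanged:
commuting derivatives, anticommuting generators. -/
theorem superDirac_type_sq {I J : Type*} [Fintype I] [DecidableEq I] [Fintype J] [DecidableEq J]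
    (D : I → Module.End ℝ V) (e : I → C) (p q : J → Module.End ℝ G) (a b : J → C)
    (hD : ∀ i j, D i * D j = D j * D i)
    (he : ∀ i j, e i * e j + e j * e i = algebraMap ℝ C (if i = j then -2 else 0))
    (hp : ∀ j k, p j * p k + p k * p j = 0) (hq : ∀ j k, q j * q k + q k * q j = 0)
    (hpq : ∀ j k, p j * q k + q k * p j = 0)
    (ha : ∀ j k, a j * a k = a k * a j) (hb : ∀ j k, b j * b k = b k * b j)
    (hab : ∀ j k, b j * a k - a k * b j = algebraMap ℝ C (if j = k then 1 else 0))
    (hea : ∀ i j, e i * a j + a j * e i = 0) (heb : ∀ i j, e i * b j + b j * e i = 0) :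
    ((2 : ℝ) • ∑ j, (tensorOp 1 (p j) (a j) - tensorOp 1 (q j) (b j))
      - ∑ i, tensorOp (D i) 1 (e i)) ^ 2 =
    tensorOp (-∑ i, D i * D i) 1 1 + (4 : ℝ) • tensorOp 1 (∑ j, p j * q j) 1 := by
  have hg (j k : J) : p j * q k = (-1 : ℝ) • (q k * p j) := by
    rw [neg_one_smul]
    exact eq_neg_of_add_eq_zero_left (hpq _ _)
  rw [← tensorOp_sum_grassmann, add_comm]
  refine (sq_smul_sum_sub_of_anticomm _ _ _ (fun j => tensorOp 1 (p j * q j) 1)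
    (fun i => tensorOp (D i * D i) 1 1) (fun j k => ?_) (fun j k => ?_) (fun j k => ?_)
    (fun i j => ?_) (fun i j => ?_) fun i j => ?_).trans ?_
  · rw [tensorOp_mul, tensorOp_mul, ha k j, tensorOp_add_grassmann, hp, tensorOp_zero_grassmann]
  · rw [tensorOp_mul, tensorOp_mul, hb k j, tensorOp_add_grassmann, hq, tensorOp_zero_grassmann]
  · have hg' : q k * p j = (-1 : ℝ) • (p j * q k) := by rw [hg, smul_smul]; simp
    have hs : a j * b k + (-1 : ℝ) • (b k * a j) = algebraMap ℝ C (if k = j then -1 else 0) := by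
      rw [neg_one_smul, ← sub_eq_add_neg, ← neg_sub, hab, ← map_neg]
      congr 1
      split_ifs <;> simp
    rw [tensorOp_mul, tensorOp_mul, hg', tensorOp_smul_grassmann, ← tensorOp_smul_clifford,
      tensorOp_add_clifford, hs]
    by_cases h : j = k
    · rw [if_pos h, if_pos h.symm, h, Algebra.algebraMap_eq_smul_one, tensorOp_smul_clifford, mul_one]
    · rw [if_neg h, if_neg (Ne.symm h), map_zero, tensorOp_zero_clifford]
  · rw [tensorOp_mul, tensorOp_mul, one_mul, mul_one, one_mul, mul_one, tensorOp_add_clifford, hea,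
      tensorOp_zero_clifford]
  · rw [tensorOp_mul, tensorOp_mul, one_mul, mul_one, one_mul, mul_one, tensorOp_add_clifford, heb,
      tensorOp_zero_clifford]
  · rw [tensorOp_mul, tensorOp_mul, hD j i, tensorOp_add_clifford, he]
    split_ifs with h
    · rw [h, Algebra.algebraMap_eq_smul_one, tensorOp_smul_clifford, mul_one]
    · rw [map_zero, tensorOp_zero_clifford]
  · rw [tensorOp_sum_distr, ← tensorOp_smul_distr, neg_one_smul]

end TensorOp

/-! ### The Clifford algebra and the super Laplace operator -/

section Clifford

variable {m n : ℕ}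

theorem Clifford.mk_eq_of_rel {a b : FreeAlgebra ℝ (Fin m ⊕ Fin (2 * n))} (h : CliffordRel m n a b) :
    Clifford.mk m n a = Clifford.mk m n b :=
  RingQuot.mkAlgHom_rel ℝ h

theorem oGen_mul_oGen_add (i j : Fin m) :
    (oGen i * oGen j + oGen j * oGen i : Clifford m n)
      = algebraMap ℝ _ (if i = j then -2 else 0) := by
  simpa only [map_add, map_mul, AlgHom.commutes, oGen, sGen] using
    Clifford.mk_eq_of_rel (CliffordRel.orth (n := n) i j)

theorem sGen_even_mul_even (j k : Fin n) :
    (sGen (evenIdx j) * sGen (evenIdx k) : Clifford m n) = sGen (evenIdx k) * sGen (evenIdx j) := by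
  refine sub_eq_zero.1 ?_
  simpa only [map_sub, map_mul, map_zero, oGen, sGen] using
    Clifford.mk_eq_of_rel (CliffordRel.even_even (m := m) j k)

theorem sGen_odd_mul_odd (j k : Fin n) :
    (sGen (oddIdx j) * sGen (oddIdx k) : Clifford m n) = sGen (oddIdx k) * sGen (oddIdx j) := by
  refine sub_eq_zero.1 ?_
  simpa only [map_sub, map_mul, map_zero, oGen, sGen] using
    Clifford.mk_eq_of_rel (CliffordRel.odd_odd (m := m) j k)

theorem sGen_odd_mul_even (j k : Fin n) :
    (sGen (oddIdx j) * sGen (evenIdx k) - sGen (evenIdx k) * sGen (oddIdx j) : Clifford m n)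
      = algebraMap ℝ _ (if j = k then 1 else 0) := by
  simpa only [map_sub, map_mul, AlgHom.commutes, oGen, sGen] using
    Clifford.mk_eq_of_rel (CliffordRel.odd_even (m := m) j k)

theorem oGen_mul_sGen_add (i : Fin m) (j : Fin (2 * n)) :
    (oGen i * sGen j + sGen j * oGen i : Clifford m n) = 0 := by
  simpa only [map_add, map_mul, map_zero, oGen, sGen] using
    Clifford.mk_eq_of_rel (CliffordRel.mixed (n := n) i j)

/-- Same mechanism as in `superDirac_type_sq`, with anticommuting variables in place of derivatives:
only the commutator of conjugate symplectic generators survives. -/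
theorem fermVec_mul_self : fermVec m n * fermVec m n = gquad n ⊗ₜ[ℝ] (1 : Clifford m n) := by
  rw [fermVec, Fin.sum_univ_two_mul, gquad, TensorProduct.sum_tmul]
  refine sum_add_sq_of_anticomm _ _ _ (fun j k => ?_) (fun j k => ?_) (fun j k => ?_)
  · simp only [Algebra.TensorProduct.tmul_mul_tmul]
    rw [sGen_odd_mul_odd k j, ← TensorProduct.add_tmul, gvar_mul_gvar_add, TensorProduct.zero_tmul]
  · simp only [Algebra.TensorProduct.tmul_mul_tmul]
    rw [sGen_even_mul_even k j, ← TensorProduct.add_tmul, gvar_mul_gvar_add, TensorProduct.zero_tmul]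
  · simp only [Algebra.TensorProduct.tmul_mul_tmul]
    rw [gvar_mul_gvar_comm (evenIdx k), TensorProduct.neg_tmul, ← sub_eq_add_neg,
      ← TensorProduct.tmul_sub, sGen_odd_mul_even]
    split_ifs with h
    · rw [h, map_one, gpair]
    · rw [map_zero, TensorProduct.tmul_zero]

theorem fermVec_pow_two_mul (s : ℕ) :
    fermVec m n ^ (2 * s) = (gquad n ^ s) ⊗ₜ[ℝ] (1 : Clifford m n) := by
  rw [pow_mul, pow_two, fermVec_mul_self, Algebra.TensorProduct.tmul_pow, one_pow]

/-! ### Commuting distributional derivatives and the splitting of the super Laplacian -/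

theorem contDiff_testFunction (φ : 𝓓((⊤ : Opens (E m)), ℝ)) (k : ℕ) : ContDiff ℝ k φ :=
  φ.contDiff.of_le (by exact_mod_cast le_top)

theorem testFunction_lineDeriv_eq_fderiv (φ : 𝓓((⊤ : Opens (E m)), ℝ)) (v x : E m) :
    (TestFunction.lineDerivCLM ℝ v φ : 𝓓((⊤ : Opens (E m)), ℝ)) x = fderiv ℝ φ x v := by
  rw [TestFunction.lineDerivCLM_eq_fderivCLM, TestFunction.fderivCLM_apply_of_le _ (by simp)]

theorem testFunction_lineDeriv_comm (φ : 𝓓((⊤ : Opens (E m)), ℝ)) (v w : E m) :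
    (TestFunction.lineDerivCLM ℝ v (TestFunction.lineDerivCLM ℝ w φ : 𝓓((⊤ : Opens (E m)), ℝ)) :
      𝓓((⊤ : Opens (E m)), ℝ)) = TestFunction.lineDerivCLM ℝ w
        (TestFunction.lineDerivCLM ℝ v φ : 𝓓((⊤ : Opens (E m)), ℝ)) := by
  ext x
  have hfun (u : E m) : ((TestFunction.lineDerivCLM ℝ u φ : 𝓓((⊤ : Opens (E m)), ℝ)) : E m → ℝ)
      = fun x => fderiv ℝ φ x u := funext fun x => testFunction_lineDeriv_eq_fderiv φ u x
  have hd : DifferentiableAt ℝ (fderiv ℝ φ) x :=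
    ((contDiff_testFunction φ 2).fderiv_right (m := 1) (by norm_num)).differentiable (by simp) x
  rw [testFunction_lineDeriv_eq_fderiv, testFunction_lineDeriv_eq_fderiv, hfun, hfun,
    fderiv_clm_apply hd (by fun_prop), fderiv_clm_apply hd (by fun_prop)]
  simpa using ((contDiff_testFunction φ 2).contDiffAt.isSymmSndFDerivAt (by simp)).eq v w

theorem bderiv_apply (i : Fin m) (T : Distr m) (φ : 𝓓((⊤ : Opens (E m)), ℝ)) :
    bderiv i T φ = -T (TestFunction.lineDerivCLM ℝ (EuclideanSpace.single i (1 : ℝ)) φ) := rfl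

theorem bderiv_mul_comm (i j : Fin m) : bderiv i * bderiv j = bderiv j * bderiv i := by
  refine LinearMap.ext fun T => ?_
  ext φ
  simp only [Module.End.mul_apply, bderiv_apply, testFunction_lineDeriv_comm φ
    (EuclideanSpace.single i 1)]

/-- The index crossing of the Dirac operator matters: odd derivatives go with even generators, so
that the commutator hypothesis is the defining relation `odd_even`. -/
theorem superLaplace_eq :
    superLaplace m n = tensorOp (bLaplace m) 1 1 + (4 : ℝ) • tensorOp 1 (gLap n) 1 :=
  superDirac_type_sq bderiv oGen (fun j => gderiv (oddIdx j)) (fun j => gderiv (evenIdx j))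
    (fun j => sGen (evenIdx j)) (fun j => sGen (oddIdx j)) bderiv_mul_comm oGen_mul_oGen_add
    (fun _ _ => gderiv_mul_gderiv_add _ _) (fun _ _ => gderiv_mul_gderiv_add _ _)
    (fun _ _ => gderiv_mul_gderiv_add _ _) sGen_even_mul_even sGen_odd_mul_odd sGen_odd_mul_even
    (fun _ _ => oGen_mul_sGen_add _ _) (fun _ _ => oGen_mul_sGen_add _ _)

theorem superLaplace_tmul (f : Distr m) (a : Grassmann n) :
    superLaplace m n (f ⊗ₜ (a ⊗ₜ 1)) =
      bLaplace m f ⊗ₜ (a ⊗ₜ 1) + (4 : ℝ) • (f ⊗ₜ (gLap n a ⊗ₜ 1)) := by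
  rw [superLaplace_eq, LinearMap.add_apply, LinearMap.smul_apply, tensorOp_tmul, tensorOp_tmul,
    one_mul]
  rfl

end Clifford

/-! ### Fundamental solutions of powers of the super Laplace operator -/

section SuperNu

variable {m n : ℕ} {ν : ℕ → L1loc m}

/-- The coefficients of the fundamental solutions, `k` standing for `k + 1`. -/
noncomputable def superNuCoeff (n k l : ℕ) : ℝ :=
  (4 : ℝ) ^ l * ((l + k).factorial : ℝ) / (((n - l).factorial : ℝ) * (k.factorial : ℝ))

theorem toSuperDistr_superNu (k : ℕ) :
    toSuperDistr m n (superNu n ν (k + 1)) =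
      ∑ l ∈ Finset.range (n + 1), superNuCoeff n k l •
        (toDistr m (ν (l + (k + 1))) ⊗ₜ[ℝ] ((gquad n ^ (n - l)) ⊗ₜ[ℝ] (1 : Clifford m n))) := by
  rw [superNu, map_sum]
  refine Finset.sum_congr rfl fun l _ => ?_
  rw [map_smul, ← Nat.mul_sub, fermVec_pow_two_mul]
  rfl

theorem superLaplace_tmul_gquad_pow (f : Distr m) (s : ℕ) :
    superLaplace m n (f ⊗ₜ ((gquad n ^ (s + 1)) ⊗ₜ 1)) =
      bLaplace m f ⊗ₜ ((gquad n ^ (s + 1)) ⊗ₜ 1)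
        + (-(4 * ((s + 1) * (n - s))) : ℝ) • (f ⊗ₜ ((gquad n ^ s) ⊗ₜ 1)) := by
  rw [superLaplace_tmul, gLap_gquad_pow_succ, ← TensorProduct.smul_tmul', TensorProduct.tmul_smul,
    smul_smul]
  congr 3
  ring

/-- One application of the super Laplace operator, with the two contributions to each power of
the fermionic vector variable collected. -/
theorem superLaplace_toSuperDistr_superNu (k : ℕ) :
    superLaplace m n (toSuperDistr m n (superNu n ν (k + 1))) =
      superNuCoeff n k 0 • (bLaplace m (toDistr m (ν (k + 1))) ⊗ₜ[ℝ]
          ((gquad n ^ n) ⊗ₜ[ℝ] (1 : Clifford m n))) +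
      ∑ l ∈ Finset.range n,
        (superNuCoeff n k (l + 1) • (bLaplace m (toDistr m (ν (l + 1 + (k + 1)))) ⊗ₜ[ℝ]
          ((gquad n ^ (n - (l + 1))) ⊗ₜ[ℝ] (1 : Clifford m n)))
        + (-(superNuCoeff n k l * (4 * ((n - l) * (l + 1))))) •
          (toDistr m (ν (l + (k + 1))) ⊗ₜ[ℝ]
            ((gquad n ^ (n - (l + 1))) ⊗ₜ[ℝ] (1 : Clifford m n)))) := by
  have h1 : ∀ l ∈ Finset.range n, superLaplace m n (superNuCoeff n k l •
        (toDistr m (ν (l + (k + 1))) ⊗ₜ[ℝ] ((gquad n ^ (n - l)) ⊗ₜ[ℝ] (1 : Clifford m n)))) =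
      superNuCoeff n k l • (bLaplace m (toDistr m (ν (l + (k + 1)))) ⊗ₜ[ℝ]
          ((gquad n ^ (n - l)) ⊗ₜ[ℝ] (1 : Clifford m n)))
        + (-(superNuCoeff n k l * (4 * ((n - l) * (l + 1))))) •
          (toDistr m (ν (l + (k + 1))) ⊗ₜ[ℝ]
            ((gquad n ^ (n - (l + 1))) ⊗ₜ[ℝ] (1 : Clifford m n))) := by
    intro l hl
    have hl' : l < n := Finset.mem_range.1 hl
    obtain ⟨s, hs⟩ : ∃ s, n - l = s + 1 := ⟨n - (l + 1), by omega⟩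
    have hn : (n : ℝ) = l + s + 1 := by exact_mod_cast (by omega : n = l + s + 1)
    have hs' : n - (l + 1) = s := by omega
    rw [map_smul, hs, hs', superLaplace_tmul_gquad_pow, smul_add, smul_smul]
    congr 2
    rw [hn]
    ring
  rw [toSuperDistr_superNu, map_sum, Finset.sum_range_succ, Finset.sum_congr rfl h1,
    Finset.sum_add_distrib, Finset.sum_add_distrib, Nat.sub_self, pow_zero, map_smul,
    superLaplace_tmul, gLap_one, TensorProduct.zero_tmul, TensorProduct.tmul_zero, smul_zero,
    add_zero, add_right_comm, ← add_assoc (superNuCoeff n k 0 • _)]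
  congr 1
  -- The bosonic terms are put back into one sum up to l = n, then split at l = 0 instead of l = n,
  -- so that their powers of θ line up with the fermionic terms.
  have h2 := Finset.sum_range_succ (fun l => superNuCoeff n k l •
    (bLaplace m (toDistr m (ν (l + (k + 1)))) ⊗ₜ[ℝ]
      ((gquad n ^ (n - l)) ⊗ₜ[ℝ] (1 : Clifford m n)))) n
  rw [Nat.sub_self, pow_zero] at h2
  rw [← h2, Finset.sum_range_succ', add_comm, Nat.sub_zero, zero_add]

theorem SuperSpace.IsPolyharmonicSequence.bLaplace_succ (hν : IsPolyharmonicSequence ν) {l : ℕ} (hl : l ≠ 0) :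
    bLaplace m (toDistr m (ν (l + 1))) = toDistr m (ν l) := by
  simpa using (hν (l + 1) (by omega)).1 1 (by omega)

theorem SuperSpace.IsPolyharmonicSequence.bLaplace_one (hν : IsPolyharmonicSequence ν) :
    bLaplace m (toDistr m (ν 1)) = Distribution.delta 0 := by
  simpa using (hν 1 le_rfl).2

/-- The fermionic contribution is the fraction (l+1)/(l+1+k) of the bosonic one. For k = 0 it
cancels it; otherwise the remaining fraction k/(l+1+k) lowers k by one in the coefficient. -/
theorem superNuCoeff_mul_eq {k l : ℕ} (hl : l < n) :
    superNuCoeff n k l * (4 * ((n - l) * (l + 1)))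
      = (l + 1 : ℝ) / (l + 1 + k) * superNuCoeff n k (l + 1) := by
  obtain ⟨s, rfl⟩ : ∃ s, n = l + s + 1 := ⟨n - (l + 1), by omega⟩
  rw [superNuCoeff, superNuCoeff, show l + s + 1 - l = s + 1 by omega,
    show l + s + 1 - (l + 1) = s by omega, show l + 1 + k = (l + k) + 1 by omega,
    Nat.factorial_succ, Nat.factorial_succ]
  have : (l + 1 + k : ℝ) ≠ 0 := by positivity
  push_cast
  field_simp
  ring

theorem superLaplace_superNu_one (hν : IsPolyharmonicSequence ν) :
    superLaplace m n (toSuperDistr m n (superNu n ν 1)) = superDelta m n := by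
  rw [superLaplace_toSuperDistr_superNu 0, Finset.sum_eq_zero, add_zero, zero_add, hν.bLaplace_one,
    gquad_pow_self, ← TensorProduct.smul_tmul', TensorProduct.tmul_smul, smul_smul, superDelta]
  · have : superNuCoeff n 0 0 * n.factorial = 1 := by
      simp [superNuCoeff, Nat.factorial_ne_zero]
    rw [this, one_smul]
  · intro l hl
    have : (l + 1 : ℝ) ≠ 0 := by positivity
    rw [superNuCoeff_mul_eq (Finset.mem_range.1 hl), zero_add, hν.bLaplace_succ (by omega),
      Nat.cast_zero, add_zero, div_self this, one_mul, ← add_smul, add_neg_cancel, zero_smul]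

theorem superLaplace_superNu_succ (hν : IsPolyharmonicSequence ν) (k : ℕ) :
    superLaplace m n (toSuperDistr m n (superNu n ν (k + 2))) =
      toSuperDistr m n (superNu n ν (k + 1)) := by
  rw [superLaplace_toSuperDistr_superNu (k + 1), toSuperDistr_superNu, Finset.sum_range_succ',
    add_comm]
  congr 1
  · refine Finset.sum_congr rfl fun l hl => ?_
    rw [superNuCoeff_mul_eq (Finset.mem_range.1 hl), show l + 1 + (k + 1 + 1) = (l + k + 2) + 1 by omega,
      hν.bLaplace_succ (by omega), show l + (k + 1 + 1) = l + k + 2 by omega,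
      show l + 1 + (k + 1) = l + k + 2 by omega, ← add_smul]
    congr 1
    rw [superNuCoeff, superNuCoeff, show l + 1 + (k + 1) = (l + 1 + k) + 1 by omega,
      Nat.factorial_succ, Nat.factorial_succ]
    have h1 : (l + 1 + (k + 1) : ℝ) ≠ 0 := by positivity
    push_cast
    field_simp
    ring
  · rw [zero_add, hν.bLaplace_succ (by omega), Nat.sub_zero]
    congr 1
    simp only [superNuCoeff, pow_zero, zero_add, Nat.sub_zero]
    field_simp

theorem superLaplace_pow_superNu (hν : IsPolyharmonicSequence ν) (k : ℕ) :
    (superLaplace m n ^ (k + 1)) (toSuperDistr m n (superNu n ν (k + 1))) = superDelta m n := by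
  induction k with
  | zero => rw [zero_add, pow_one, superLaplace_superNu_one hν]
  | succ k ih => rw [pow_succ, Module.End.mul_apply, superLaplace_superNu_succ hν, ih]

end SuperNu

/-! ### Radial functions `w ^ a * (A + B * log w)` of `w = ‖x‖ ^ 2` -/

section LogPow

open Filter Set Topology

/-- The functions `w ^ a * (A + B * log w)`. -/
noncomputable def logPow (a A B w : ℝ) : ℝ := w ^ a * (A + B * Real.log w)

theorem hasDerivAt_logPow (a A B : ℝ) {w : ℝ} (hw : 0 < w) :
    HasDerivAt (logPow a A B) (logPow (a - 1) (a * A + B) (a * B) w) w := by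
  have h := (Real.hasDerivAt_rpow_const (p := a) (Or.inl hw.ne')).mul
    (((Real.hasDerivAt_log hw.ne').const_mul B).const_add A)
  refine h.congr_deriv ?_
  rw [logPow, Real.rpow_sub_one hw.ne']
  field_simp
  ring

theorem continuousOn_logPow (a A B : ℝ) : ContinuousOn (logPow a A B) (Ioi 0) :=
  fun _ hw => (hasDerivAt_logPow a A B hw).continuousAt.continuousWithinAt

theorem measurable_logPow (a A B : ℝ) : Measurable (logPow a A B) := by
  unfold logPow
  fun_prop

theorem mul_logPow (a A B : ℝ) {w : ℝ} (hw : 0 < w) :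
    w * logPow (a - 1) A B w = logPow a A B w := by
  rw [logPow, logPow, Real.rpow_sub_one hw.ne']
  field_simp

theorem logPow_add (a A B A' B' w : ℝ) :
    logPow a A B w + logPow a A' B' w = logPow a (A + A') (B + B') w := by
  simp only [logPow]; ring

theorem const_mul_logPow (c a A B w : ℝ) :
    c * logPow a A B w = logPow a (c * A) (c * B) w := by
  simp only [logPow]; ring

/-- The logarithm costs an arbitrarily small power. The bound β < d makes ‖x‖^(-2β) locally
integrable for d = m/2, and β ≥ 0 makes w^(-β) decreasing, hence a bound uniform in the
regularization. -/
theorem exists_abs_logPow_le {d a : ℝ} (hd : 0 < d) (ha : -d < a) (A B : ℝ) :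
    ∃ β, 0 ≤ β ∧ β < d ∧ ∀ R, 0 < R → ∃ C, ∀ w, 0 < w → w ≤ R →
      |logPow a A B w| ≤ C * w ^ (-β) := by
  -- Strictness β > -a leaves a positive power w^(a+β) to absorb the logarithm near 0.
  obtain ⟨β, hβ1, hβ2⟩ : ∃ β, max 0 (-a) < β ∧ β < d :=
    exists_between (max_lt hd (by linarith))
  have hβ0 : 0 < β := (le_max_left _ _).trans_lt hβ1
  have hs : 0 < a + β := by linarith [(le_max_right 0 (-a)).trans_lt hβ1]
  refine ⟨β, hβ0.le, hβ2, fun R hR => ⟨R ^ (a + β) * |A| + |B| * (1 / (a + β) + R ^ (a + β) * R),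
    fun w hw hwR => ?_⟩⟩
  have hlog : |Real.log w * w ^ (a + β)| ≤ 1 / (a + β) + R ^ (a + β) * R := by
    rcases le_total w 1 with h1 | h1
    · exact (Real.abs_log_mul_self_rpow_lt w _ hw h1 hs).le.trans
        (le_add_of_nonneg_right (by positivity))
    · refine le_trans ?_ (le_add_of_nonneg_left (by positivity))
      rw [abs_of_nonneg (mul_nonneg (Real.log_nonneg h1) (by positivity)), mul_comm]
      exact mul_le_mul (Real.rpow_le_rpow hw.le hwR hs.le)
        ((Real.log_le_self hw.le).trans hwR) (Real.log_nonneg h1) (by positivity)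
  have hpow : w ^ (a + β) ≤ R ^ (a + β) := Real.rpow_le_rpow hw.le hwR hs.le
  have heq : logPow a A B w = (w ^ (a + β) * A + B * (Real.log w * w ^ (a + β))) * w ^ (-β) := by
    rw [logPow, Real.rpow_neg hw.le, Real.rpow_add hw]
    have := (Real.rpow_pos_of_pos hw β).ne'
    field_simp
  rw [heq, abs_mul, abs_of_pos (Real.rpow_pos_of_pos hw (-β))]
  refine mul_le_mul_of_nonneg_right ((abs_add_le _ _).trans (add_le_add ?_ ?_)) (by positivity)
  · rw [abs_mul, abs_of_pos (Real.rpow_pos_of_pos hw _)]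
    exact mul_le_mul_of_nonneg_right hpow (abs_nonneg _)
  · rw [abs_mul]
    exact mul_le_mul_of_nonneg_left hlog (abs_nonneg _)

end LogPow

/-! ### Local integrability of radial functions and removal of the regularization -/

section Radial

open Filter Set Topology

variable {m : ℕ}

theorem ae_ne_zero_of_dim_ne_zero (hm : m ≠ 0) : ∀ᵐ x : E m, x ≠ 0 := by
  have : Nontrivial (E m) := Module.nontrivial_of_finrank_pos (R := ℝ) (by simp; omega)
  exact Measure.ae_ne volume 0

theorem sq_norm_rpow_neg (x : E m) (β : ℝ) : (‖x‖ ^ 2) ^ (-β) = ‖x‖ ^ (-(2 * β)) := by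
  rw [← Real.rpow_natCast_mul (norm_nonneg x)]
  congr 1
  push_cast
  ring

theorem locallyIntegrable_logPow_norm_sq (hm : m ≠ 0) {a : ℝ} (ha : -(m / 2 : ℝ) < a) (A B : ℝ) :
    LocallyIntegrable (fun x : E m => logPow a A B (‖x‖ ^ 2)) volume := by
  have hd : (0 : ℝ) < m / 2 := by positivity
  obtain ⟨β, hβ0, hβ, hC⟩ := exists_abs_logPow_le hd ha A B
  rw [locallyIntegrable_iff]
  intro K hK
  obtain ⟨R, hR0, hR⟩ := hK.isBounded.exists_pos_norm_lt
  obtain ⟨C, hC⟩ := hC (R ^ 2) (by positivity)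
  refine IntegrableOn.mono_set (t := Metric.ball 0 R) ?_ fun x hx => mem_ball_zero_iff.2 (hR x hx)
  refine integrableOn_ball_of_norm_le_rpow (by simp; omega) (C := C) (α := 2 * β)
    (by simp; linarith) ?_
    ((measurable_logPow a A B).comp (by fun_prop)).aestronglyMeasurable
  filter_upwards [ae_restrict_mem Metric.isOpen_ball.measurableSet,
    ae_restrict_of_ae (ae_ne_zero_of_dim_ne_zero hm)] with x hx hx0
  rw [Real.norm_eq_abs, ← sq_norm_rpow_neg]
  have := norm_pos_iff.2 hx0
  refine hC _ (by positivity) ?_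
  have := mem_ball_zero_iff.1 hx
  gcongr

/-- Removing the regularization from integrals of radial functions against test functions. -/
theorem tendsto_integral_regularized (hm : m ≠ 0) {a A B : ℝ} (ha : -(m / 2 : ℝ) < a)
    (u : ℝ → ℝ → ℝ) (u₀ : ℝ → ℝ) (hu : ∀ ε, 0 < ε → ContinuousOn (u ε) (Ioi 0))
    (hb : ∀ ε w, 0 < ε → ε ≤ w → |u ε w| ≤ |logPow a A B w|)
    (hlim : ∀ t, 0 < t → Tendsto (fun ε => u ε (t + ε)) (𝓝[>] 0) (𝓝 (u₀ t)))
    {φ : E m → ℝ} (hφ : Continuous φ) (hφc : HasCompactSupport φ) :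
    Tendsto (fun ε => ∫ x, φ x * u ε (‖x‖ ^ 2 + ε)) (𝓝[>] 0) (𝓝 (∫ x, φ x * u₀ (‖x‖ ^ 2))) := by
  have hd : (0 : ℝ) < m / 2 := by positivity
  obtain ⟨β, hβ0, hβ, hC⟩ := exists_abs_logPow_le hd ha A B
  obtain ⟨R, hR0, hR⟩ := hφc.isCompact.isBounded.exists_pos_norm_lt
  obtain ⟨C, hC⟩ := hC (R ^ 2 + 1) (by positivity)
  -- The bound evaluated at w = 1, admissible because the range was taken up to R² + 1.
  have hC0 : 0 ≤ C := by
    have h := (abs_nonneg _).trans (hC 1 one_pos (by nlinarith))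
    simpa using h
  have hloc : LocallyIntegrable (fun x : E m => C * ‖x‖ ^ (-(2 * β))) volume := by
    refine locallyIntegrable_of_norm_le_rpow (by simp; omega) (C := C) (α := 2 * β)
      (by simp; linarith) (Eventually.of_forall fun x => ?_) ?_
    · rw [Real.norm_of_nonneg (by positivity)]
    · exact Measurable.aestronglyMeasurable (by fun_prop)
  have hε : Ioc (0 : ℝ) 1 ∈ 𝓝[>] (0 : ℝ) := Ioc_mem_nhdsGT one_pos
  refine tendsto_integral_filter_of_dominated_convergence
    (fun x => |φ x| * (C * ‖x‖ ^ (-(2 * β)))) ?_ ?_ ?_ ?_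
  · filter_upwards [hε] with ε hε
    refine Continuous.aestronglyMeasurable (hφ.mul ?_)
    refine (hu ε hε.1).comp_continuous (by fun_prop) fun x => ?_
    have := hε.1
    simp only [mem_Ioi]
    positivity
  · filter_upwards [hε] with ε hε
    filter_upwards [ae_ne_zero_of_dim_ne_zero hm] with x hx
    rw [norm_mul, Real.norm_eq_abs, Real.norm_eq_abs]
    by_cases hφx : φ x = 0
    · simp [hφx]
    have hx0 : 0 < ‖x‖ := norm_pos_iff.2 hx
    have hxR : ‖x‖ < R := hR x (subset_tsupport _ hφx)
    refine mul_le_mul_of_nonneg_left ?_ (abs_nonneg _)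
    have h0 := hε.1
    have h1 := hε.2
    refine (hb ε _ h0 (by nlinarith)).trans ((hC _ (by positivity) (by nlinarith)).trans ?_)
    rw [← sq_norm_rpow_neg]
    refine mul_le_mul_of_nonneg_left ?_ hC0
    exact Real.rpow_le_rpow_of_nonpos (by positivity) (by linarith) (by linarith)
  · exact hloc.integrable_smul_left_of_hasCompactSupport hφ.abs (hφc.comp_left abs_zero)
  · filter_upwards [ae_ne_zero_of_dim_ne_zero hm] with x hx
    have hx0 : 0 < ‖x‖ := norm_pos_iff.2 hx
    exact (hlim _ (by positivity)).const_mul _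

/-! ### Integration by parts against regularized radial functions -/

theorem hasLineDerivAt_comp_norm_sq_add {g g' : ℝ → ℝ} (hg : ∀ w, 0 < w → HasDerivAt g (g' w) w)
    {ε : ℝ} (hε : 0 < ε) (x : E m) (i : Fin m) :
    HasLineDerivAt ℝ (fun x : E m => g (‖x‖ ^ 2 + ε)) (2 * x i * g' (‖x‖ ^ 2 + ε)) x
      (EuclideanSpace.single i (1 : ℝ)) := by
  have h1 : HasFDerivAt (fun x : E m => ‖x‖ ^ 2 + ε) (2 • innerSL ℝ x) x :=
    (hasStrictFDerivAt_norm_sq x).hasFDerivAt.add_const ε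
  have h2 := ((hg (‖x‖ ^ 2 + ε) (by positivity)).comp_hasFDerivAt x h1).hasLineDerivAt
    (EuclideanSpace.single i (1 : ℝ))
  refine HasDerivAt.congr_deriv h2 ?_
  have h3 : inner ℝ x (EuclideanSpace.single i (1 : ℝ)) = x i := by
    simpa using EuclideanSpace.inner_single_right (𝕜 := ℝ) i 1 x
  simp [h3]
  ring

theorem hasLineDerivAt_coord (x : E m) (i : Fin m) :
    HasLineDerivAt ℝ (fun x : E m => x i) 1 x (EuclideanSpace.single i (1 : ℝ)) := by
  have h := ((EuclideanSpace.proj i : E m →L[ℝ] ℝ).hasFDerivAt (x := x)).hasLineDerivAt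
    (EuclideanSpace.single i (1 : ℝ))
  refine HasDerivAt.congr_deriv h ?_
  simp

theorem testFunction_hasLineDerivAt (φ : 𝓓((⊤ : Opens (E m)), ℝ)) (v x : E m) :
    HasLineDerivAt ℝ φ ((TestFunction.lineDerivCLM ℝ v φ : 𝓓((⊤ : Opens (E m)), ℝ)) x) x v := by
  rw [testFunction_lineDeriv_eq_fderiv]
  exact (((contDiff_testFunction φ 1).differentiable (by simp)) x).hasFDerivAt.hasLineDerivAt v

theorem integral_lineDeriv_mul_eq_neg (φ : 𝓓((⊤ : Opens (E m)), ℝ)) (v : E m) {f f' : E m → ℝ}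
    (hf : Continuous f) (hf' : Continuous f') (h : ∀ x, HasLineDerivAt ℝ f (f' x) x v) :
    ∫ x, (TestFunction.lineDerivCLM ℝ v φ : 𝓓((⊤ : Opens (E m)), ℝ)) x * f x
      = -∫ x, φ x * f' x := by
  have hint (ψ : 𝓓((⊤ : Opens (E m)), ℝ)) {k : E m → ℝ} (hk : Continuous k) :
      Integrable (fun x => ψ x * k x) volume :=
    (ψ.continuous.mul hk).integrable_of_hasCompactSupport ψ.hasCompactSupport.mul_right
  have := integral_bilinear_hasLineDerivAt_right_eq_neg_left_of_integrable
    (B := ContinuousLinearMap.mul ℝ ℝ) (f := φ) (g := f) (μ := volume) (v := v)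
    (hint _ hf) (hint _ hf') (hint _ hf) (fun x _ => testFunction_hasLineDerivAt φ v x) fun x _ => h x
  simp only [ContinuousLinearMap.mul_apply'] at this
  rw [this, neg_neg]

/-- The second derivative of a test function in a coordinate direction. -/
noncomputable def secondDeriv (i : Fin m) (φ : 𝓓((⊤ : Opens (E m)), ℝ)) :
    𝓓((⊤ : Opens (E m)), ℝ) :=
  TestFunction.lineDerivCLM ℝ (EuclideanSpace.single i (1 : ℝ))
    (TestFunction.lineDerivCLM ℝ (EuclideanSpace.single i (1 : ℝ)) φ : 𝓓((⊤ : Opens (E m)), ℝ))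

theorem integral_secondDeriv_mul_radial (φ : 𝓓((⊤ : Opens (E m)), ℝ)) {g g' g'' : ℝ → ℝ}
    (hg : ∀ w, 0 < w → HasDerivAt g (g' w) w) (hg' : ∀ w, 0 < w → HasDerivAt g' (g'' w) w)
    (hg'' : ContinuousOn g'' (Ioi 0)) {ε : ℝ} (hε : 0 < ε) (i : Fin m) :
    ∫ x, secondDeriv i φ x * g (‖x‖ ^ 2 + ε) =
      ∫ x, φ x * (2 * g' (‖x‖ ^ 2 + ε) + 4 * x i ^ 2 * g'' (‖x‖ ^ 2 + ε)) := by
  have hc {k : ℝ → ℝ} (hk : ContinuousOn k (Ioi 0)) : Continuous fun x : E m => k (‖x‖ ^ 2 + ε) :=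
    hk.comp_continuous (by fun_prop) fun x => by simp only [mem_Ioi]; positivity
  have hgc := hc (k := g) fun w hw => (hg w hw).continuousAt.continuousWithinAt
  have hgc' := hc (k := g') fun w hw => (hg' w hw).continuousAt.continuousWithinAt
  have hgc'' := hc hg''
  have hx : Continuous fun x : E m => x i := by fun_prop
  have hF' : Continuous fun x : E m => 2 * x i * g' (‖x‖ ^ 2 + ε) :=
    (continuous_const.mul hx).mul hgc'
  have hF'' : Continuous fun x : E m => 2 * g' (‖x‖ ^ 2 + ε) + 4 * x i ^ 2 * g'' (‖x‖ ^ 2 + ε) :=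
    (continuous_const.mul hgc').add ((continuous_const.mul (hx.pow 2)).mul hgc'')
  rw [secondDeriv, integral_lineDeriv_mul_eq_neg _ _ hgc hF'
      (fun x => hasLineDerivAt_comp_norm_sq_add hg hε x i),
    integral_lineDeriv_mul_eq_neg (f' := fun x => 2 * g' (‖x‖ ^ 2 + ε)
      + 4 * x i ^ 2 * g'' (‖x‖ ^ 2 + ε)) _ _ hF' hF'', neg_neg]
  intro x
  have h := HasDerivAt.mul ((hasLineDerivAt_coord x i).const_mul (2 : ℝ))
    (hasLineDerivAt_comp_norm_sq_add hg' hε x i)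
  refine HasDerivAt.congr_deriv h ?_
  simp
  ring

/-- With w = ‖x‖² + ε, the sum of the x_i² is w - ε. This isolates the radial Laplacian 2m g' + 4w
g'' in the variable w from the error -4ε g''. -/
theorem sum_integral_secondDeriv_mul_radial (φ : 𝓓((⊤ : Opens (E m)), ℝ)) {g g' g'' : ℝ → ℝ}
    (hg : ∀ w, 0 < w → HasDerivAt g (g' w) w) (hg' : ∀ w, 0 < w → HasDerivAt g' (g'' w) w)
    (hg'' : ContinuousOn g'' (Ioi 0)) {ε : ℝ} (hε : 0 < ε) :
    ∑ i, ∫ x, secondDeriv i φ x * g (‖x‖ ^ 2 + ε) =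
      ∫ x, φ x * (2 * m * g' (‖x‖ ^ 2 + ε)
        + 4 * ((‖x‖ ^ 2 + ε) * g'' (‖x‖ ^ 2 + ε)) - 4 * (ε * g'' (‖x‖ ^ 2 + ε))) := by
  have hc {k : ℝ → ℝ} (hk : ContinuousOn k (Ioi 0)) : Continuous fun x : E m => k (‖x‖ ^ 2 + ε) :=
    hk.comp_continuous (by fun_prop) fun x => by simp only [mem_Ioi]; positivity
  have hgc' := hc (k := g') fun w hw => (hg' w hw).continuousAt.continuousWithinAt
  have hgc'' := hc hg''
  simp_rw [integral_secondDeriv_mul_radial φ hg hg' hg'' hε]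
  rw [← integral_finsetSum]
  · refine integral_congr_ae (Eventually.of_forall fun x => ?_)
    simp only
    rw [← Finset.mul_sum, Finset.sum_add_distrib, ← Finset.sum_mul, ← Finset.sum_mul,
      ← Finset.mul_sum, ← EuclideanSpace.real_norm_sq_eq, Finset.sum_const, Finset.card_univ,
      Fintype.card_fin, nsmul_eq_mul]
    ring
  · intro i _
    have hx : Continuous fun x : E m => x i := by fun_prop
    exact (φ.continuous.mul ((continuous_const.mul hgc').add
      ((continuous_const.mul (hx.pow 2)).mul hgc''))).integrable_of_hasCompactSupport
      φ.hasCompactSupport.mul_right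

end Radial

/-! ### The approximate identity arising at the critical exponent -/

section Kernel

open Filter Set Topology

variable {m : ℕ}

/-- The volume of the unit ball. -/
noncomputable def ballVol (m : ℕ) : ℝ := (volume : Measure (E m)).real (Metric.ball 0 1)

theorem ballVol_pos : 0 < ballVol m :=
  ENNReal.toReal_pos (Metric.measure_ball_pos _ _ one_pos).ne' measure_ball_lt_top.ne

theorem ballVol_eq (hm : m ≠ 0) : ballVol m = Real.pi ^ (m / 2 : ℝ) / Real.Gamma (m / 2 + 1) := by
  have : Nonempty (Fin m) := ⟨⟨0, by omega⟩⟩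
  rw [ballVol, Measure.real, EuclideanSpace.volume_ball, ENNReal.ofReal_one, one_pow, one_mul,
    ENNReal.toReal_ofReal (by have := Real.Gamma_pos_of_pos (s := (m : ℝ) / 2 + 1) (by positivity); positivity),
    Fintype.card_fin, Real.sqrt_eq_rpow, ← Real.rpow_mul_natCast Real.pi_pos.le]
  congr 2
  ring

/-- An explicit primitive of the radial density in polar coordinates; it tends to 1/m at infinity,
so the kernel has total mass `ballVol m`. -/
theorem hasDerivAt_pow_mul_rpow (hm : m ≠ 0) (y : ℝ) :
    HasDerivAt (fun y : ℝ => (m : ℝ)⁻¹ * (y ^ m * (1 + y ^ 2) ^ (-(m : ℝ) / 2)))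
      (y ^ (m - 1) • (1 + y ^ 2) ^ (-((m : ℝ) + 2) / 2)) y := by
  have hpos : (0 : ℝ) < 1 + y ^ 2 := by positivity
  have hm' : (m : ℝ) ≠ 0 := by exact_mod_cast hm
  have h1 : HasDerivAt (fun y : ℝ => 1 + y ^ 2) (2 * y) y := by
    simpa using (hasDerivAt_pow 2 y).const_add 1
  have h2 := h1.rpow_const (p := -(m : ℝ) / 2) (Or.inl hpos.ne')
  refine (((hasDerivAt_pow m y).mul h2).const_mul (m : ℝ)⁻¹).congr_deriv ?_
  obtain ⟨k, rfl⟩ : ∃ k, m = k + 1 := ⟨m - 1, by omega⟩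
  have e1 : (1 + y ^ 2) ^ (-((k + 1 : ℕ) : ℝ) / 2)
      = (1 + y ^ 2) * (1 + y ^ 2) ^ (-(((k + 1 : ℕ) : ℝ) + 2) / 2) := by
    rw [show -((k + 1 : ℕ) : ℝ) / 2 = 1 + -(((k + 1 : ℕ) : ℝ) + 2) / 2 by ring,
      Real.rpow_add hpos, Real.rpow_one]
  have e2 : -((k + 1 : ℕ) : ℝ) / 2 - 1 = -(((k + 1 : ℕ) : ℝ) + 2) / 2 := by ring
  rw [e2, e1, smul_eq_mul, Nat.add_sub_cancel]
  field_simp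
  ring

theorem tendsto_pow_mul_rpow :
    Tendsto (fun y : ℝ => y ^ m * (1 + y ^ 2) ^ (-(m : ℝ) / 2)) atTop (𝓝 1) := by
  have h1 : Tendsto (fun y : ℝ => 1 - (1 + y ^ 2)⁻¹) atTop (𝓝 1) := by
    have : Tendsto (fun y : ℝ => 1 + y ^ 2) atTop atTop :=
      tendsto_atTop_add_const_left _ _ (tendsto_pow_atTop (by norm_num))
    simpa using (tendsto_inv_atTop_zero.comp this).const_sub 1
  have h2 : Tendsto (fun y : ℝ => (1 - (1 + y ^ 2)⁻¹) ^ ((m : ℝ) / 2)) atTop (𝓝 1) := by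
    simpa using h1.rpow_const (p := (m : ℝ) / 2) (Or.inl one_ne_zero)
  refine h2.congr' ?_
  filter_upwards [eventually_gt_atTop 0] with y hy
  have hpos : (0 : ℝ) < 1 + y ^ 2 := by positivity
  rw [show 1 - (1 + y ^ 2)⁻¹ = y ^ 2 / (1 + y ^ 2) by field_simp; ring,
    Real.div_rpow (by positivity) hpos.le, neg_div, Real.rpow_neg hpos.le, div_eq_mul_inv,
    ← Real.rpow_natCast_mul hy.le, show ((2 : ℕ) : ℝ) * ((m : ℝ) / 2) = m by push_cast; ring,
    Real.rpow_natCast]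

theorem integral_kernel (hm : m ≠ 0) :
    ∫ x : E m, (1 + ‖x‖ ^ 2) ^ (-((m : ℝ) + 2) / 2) = ballVol m := by
  have hm' : (m : ℝ) ≠ 0 := by exact_mod_cast hm
  have : Nontrivial (E m) := Module.nontrivial_of_finrank_pos (R := ℝ) (by simp; omega)
  have h := integral_Ioi_of_hasDerivAt_of_nonneg' (a := 0)
    (fun y _ => hasDerivAt_pow_mul_rpow hm y)
    (fun y hy => smul_nonneg (pow_nonneg (le_of_lt hy) _) (by positivity))
    (tendsto_pow_mul_rpow.const_mul (m : ℝ)⁻¹)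
  rw [integral_fun_norm_addHaar volume (fun y : ℝ => (1 + y ^ 2) ^ (-((m : ℝ) + 2) / 2)),
    finrank_euclideanSpace_fin, h]
  simp [hm, ballVol]
  field_simp

/-- The regularized Laplacian of the fundamental solution is an approximate identity. -/
theorem tendsto_integral_kernel (hm : m ≠ 0) {φ : E m → ℝ} (hφ : Continuous φ)
    (hφc : HasCompactSupport φ) :
    Tendsto (fun ε : ℝ => ∫ x, φ x * (ε * (‖x‖ ^ 2 + ε) ^ (-((m : ℝ) + 2) / 2))) (𝓝[>] 0)
      (𝓝 (ballVol m * φ 0)) := by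
  have hV := ballVol_pos (m := m)
  have h := tendsto_integral_comp_smul_smul_of_integrable (μ := (volume : Measure (E m)))
    (φ := fun x => (ballVol m)⁻¹ * (1 + ‖x‖ ^ 2) ^ (-((m : ℝ) + 2) / 2)) (g := φ)
    (fun x => by positivity) (by rw [integral_const_mul, integral_kernel hm, inv_mul_cancel₀ hV.ne'])
    ?_ (hφ.integrable_of_hasCompactSupport hφc) hφ.continuousAt
  -- Dilating the normalized kernel by c = ε^(-1/2), with the factor c^m, gives ε (‖x‖² +
  -- ε)^(-(m+2)/2) divided by `ballVol m`.
  · have hc : Tendsto (fun ε : ℝ => ε ^ (-(1 / 2) : ℝ)) (𝓝[>] 0) atTop :=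
      tendsto_rpow_neg_nhdsGT_zero (by norm_num)
    refine ((h.comp hc).const_mul (ballVol m)).congr' ?_
    filter_upwards [self_mem_nhdsWithin] with ε hε
    have hε : 0 < ε := hε
    rw [Function.comp_apply, ← integral_const_mul]
    refine integral_congr_ae (Eventually.of_forall fun x => ?_)
    have hn : ‖ε ^ (-(1 / 2) : ℝ) • x‖ ^ 2 = ε⁻¹ * ‖x‖ ^ 2 := by
      rw [norm_smul, mul_pow, Real.norm_of_nonneg (by positivity), ← Real.rpow_mul_natCast hε.le,
        ← Real.rpow_neg_one]
      norm_num
    have hw : 1 + ε⁻¹ * ‖x‖ ^ 2 = ε⁻¹ * (‖x‖ ^ 2 + ε) := by field_simp; ring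
    have hk : (ε ^ (-(1 / 2) : ℝ)) ^ m * (ε⁻¹) ^ (-((m : ℝ) + 2) / 2) = ε := by
      rw [← Real.rpow_neg_one, ← Real.rpow_mul hε.le, ← Real.rpow_mul_natCast hε.le,
        ← Real.rpow_add hε]
      convert Real.rpow_one ε using 2
      ring
    simp only [smul_eq_mul, finrank_euclideanSpace_fin]
    rw [hn, hw, Real.mul_rpow (by positivity) (by positivity)]
    generalize (‖x‖ ^ 2 + ε) ^ (-((m : ℝ) + 2) / 2) = W
    generalize (ε⁻¹) ^ (-((m : ℝ) + 2) / 2) = S at hk ⊢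
    generalize (ε ^ (-(1 / 2) : ℝ)) ^ m = M at hk ⊢
    rw [← hk]
    field_simp
  -- Decay condition: ‖x‖^m times the kernel is at most a constant times (1 + ‖x‖²)⁻¹.
  · simp only [finrank_euclideanSpace_fin]
    have h0 : Tendsto (fun x : E m => (ballVol m)⁻¹ * (1 + ‖x‖ ^ 2)⁻¹) (Bornology.cobounded (E m)) (𝓝 0) := by
      have : Tendsto (fun x : E m => 1 + ‖x‖ ^ 2) (Bornology.cobounded (E m)) atTop :=
        tendsto_atTop_add_const_left _ _
          ((tendsto_pow_atTop (by norm_num)).comp tendsto_norm_cobounded_atTop)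
      simpa using (tendsto_inv_atTop_zero.comp this).const_mul (ballVol m)⁻¹
    refine squeeze_zero (fun x => by positivity) (fun x => ?_) h0
    have hpos : (0 : ℝ) < 1 + ‖x‖ ^ 2 := by positivity
    have h1 : ‖x‖ ^ m ≤ (1 + ‖x‖ ^ 2) ^ ((m : ℝ) / 2) := by
      have : ‖x‖ ^ m = (‖x‖ ^ 2) ^ ((m : ℝ) / 2) := by
        rw [← Real.rpow_natCast_mul (norm_nonneg x), ← Real.rpow_natCast]
        congr 1
        push_cast
        ring
      rw [this]
      exact Real.rpow_le_rpow (by positivity) (by linarith) (by positivity)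
    have h2 : (1 + ‖x‖ ^ 2) ^ (-((m : ℝ) + 2) / 2) = ((1 + ‖x‖ ^ 2) ^ ((m : ℝ) / 2))⁻¹ * (1 + ‖x‖ ^ 2)⁻¹ := by
      rw [← Real.rpow_neg hpos.le, ← Real.rpow_neg_one, ← Real.rpow_add hpos]
      congr 1
      ring
    have h3 : 0 < (1 + ‖x‖ ^ 2) ^ ((m : ℝ) / 2) := by positivity
    rw [h2, mul_left_comm, ← mul_assoc (‖x‖ ^ m), ← div_eq_mul_inv (‖x‖ ^ m)]
    exact mul_le_mul_of_nonneg_left (mul_le_of_le_one_left (by positivity) ((div_le_one h3).2 h1))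
      (by positivity)

end Kernel

/-! ### The Laplace operator on radial distributions -/

section RadialDistr

open Filter Set Topology

variable {m : ℕ}

/-- The locally integrable function `x ↦ ‖x‖ ^ (2 * a) * (A + B * log (‖x‖ ^ 2))`. -/
noncomputable def radialL1loc (hm : m ≠ 0) {a : ℝ} (ha : -(m / 2 : ℝ) < a) (A B : ℝ) : L1loc m :=
  ⟨fun x => logPow a A B (‖x‖ ^ 2), locallyIntegrable_logPow_norm_sq hm ha A B⟩

theorem toDistr_apply (f : L1loc m) (φ : 𝓓((⊤ : Opens (E m)), ℝ)) :
    toDistr m f φ = ∫ x, φ x * (f : E m → ℝ) x :=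
  TestFunction.integralAgainstBilinCLM_eq_integral (f.2.locallyIntegrableOn _)

theorem bLaplace_toDistr_apply (f : L1loc m) (φ : 𝓓((⊤ : Opens (E m)), ℝ)) :
    bLaplace m (toDistr m f) φ = -∑ i, ∫ x, secondDeriv i φ x * (f : E m → ℝ) x := by
  have h (i : Fin m) : (bderiv i (bderiv i (toDistr m f))) φ
      = ∫ x, secondDeriv i φ x * (f : E m → ℝ) x := by
    rw [bderiv_apply, bderiv_apply, neg_neg, toDistr_apply]
    rfl
  have h2 : bLaplace m (toDistr m f) φ = -∑ i, (bderiv i (bderiv i (toDistr m f))) φ := by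
    let ev : Distr m →+ ℝ := AddMonoidHom.mk' (fun T => T φ) fun _ _ => rfl
    have := map_sum ev (fun i => bderiv i (bderiv i (toDistr m f))) Finset.univ
    rw [bLaplace, LinearMap.neg_apply, LinearMap.sum_apply]
    exact congrArg Neg.neg this
  rw [h2]
  simp_rw [h]

theorem tendsto_logPow_add (a A B : ℝ) {t : ℝ} (ht : 0 < t) :
    Tendsto (fun ε : ℝ => logPow a A B (t + ε)) (𝓝[>] 0) (𝓝 (logPow a A B t)) := by
  have h1 : ContinuousAt (logPow a A B) t := (hasDerivAt_logPow a A B ht).continuousAt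
  have h2 : Tendsto (fun ε : ℝ => t + ε) (𝓝[>] 0) (𝓝 t) := by
    refine tendsto_nhdsWithin_of_tendsto_nhds ?_
    simpa using (tendsto_id (α := ℝ) (x := 𝓝 0)).const_add t
  exact h1.tendsto.comp h2

/-- The first `logPow` is 2m g' + 4w g'' for g = `logPow a A B`, the second is g''. Nothing is
assumed on a - 1, so this covers both the regular and the critical exponent. -/
theorem bLaplace_radial_tendsto (hm : m ≠ 0) {a : ℝ} (ha : -(m / 2 : ℝ) < a) (A B : ℝ)
    (φ : 𝓓((⊤ : Opens (E m)), ℝ)) :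
    Tendsto (fun ε : ℝ => -∫ x, φ x * (logPow (a - 1) (4 * a * (a - 1 + m / 2) * A
          + (8 * a - 4 + 2 * m) * B) (4 * a * (a - 1 + m / 2) * B) (‖x‖ ^ 2 + ε)
        - 4 * (ε * logPow (a - 1 - 1) ((a - 1) * (a * A + B) + a * B) ((a - 1) * (a * B))
          (‖x‖ ^ 2 + ε)))) (𝓝[>] 0)
      (𝓝 (bLaplace m (toDistr m (radialL1loc hm ha A B)) φ)) := by
  rw [bLaplace_toDistr_apply]
  refine Tendsto.congr' ?_ (tendsto_finsetSum _ fun i _ => tendsto_integral_regularized hm ha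
    (fun _ => logPow a A B) (logPow a A B) (fun _ _ => continuousOn_logPow a A B)
    (fun _ _ _ _ => le_rfl) (fun t ht => ?_) (secondDeriv i φ).continuous
    (secondDeriv i φ).hasCompactSupport).neg
  · filter_upwards [self_mem_nhdsWithin] with ε hε
    have hε : 0 < ε := hε
    rw [sum_integral_secondDeriv_mul_radial φ (fun w hw => hasDerivAt_logPow a A B hw)
      (fun w hw => hasDerivAt_logPow (a - 1) _ _ hw) (continuousOn_logPow _ _ _) hε]
    congr 1
    refine integral_congr_ae (Eventually.of_forall fun x => ?_)
    simp only
    have hw : 0 < ‖x‖ ^ 2 + ε := by positivity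
    rw [mul_logPow _ _ _ hw, const_mul_logPow, const_mul_logPow, logPow_add]
    congr 2
    congr 1 <;> ring
  · exact tendsto_logPow_add a A B ht

theorem integrable_mul_logPow_add (a A B : ℝ) (φ : 𝓓((⊤ : Opens (E m)), ℝ)) {ε : ℝ} (hε : 0 < ε) :
    Integrable (fun x : E m => φ x * logPow a A B (‖x‖ ^ 2 + ε)) volume :=
  (φ.continuous.mul ((continuousOn_logPow a A B).comp_continuous (by fun_prop) fun x => by
    simp only [mem_Ioi]; positivity)).integrable_of_hasCompactSupport φ.hasCompactSupport.mul_right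

/-- The Laplace operator acts on the radial functions classically as long as the resulting function
is locally integrable. -/
theorem bLaplace_radial (hm : m ≠ 0) {a a' A B A' B' : ℝ} (ha : -(m / 2 : ℝ) < a)
    (ha' : -(m / 2 : ℝ) < a') (haa' : a' = a - 1)
    (hA : A' = -(4 * a * (a - 1 + m / 2) * A + (8 * a - 4 + 2 * m) * B))
    (hB : B' = -(4 * a * (a - 1 + m / 2) * B)) :
    bLaplace m (toDistr m (radialL1loc hm ha A B)) = toDistr m (radialL1loc hm ha' A' B') := by
  subst haa'
  ext φ
  refine tendsto_nhds_unique (bLaplace_radial_tendsto hm ha A B φ) ?_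
  set A₁ := 4 * a * (a - 1 + m / 2) * A + (8 * a - 4 + 2 * m) * B
  set B₁ := 4 * a * (a - 1 + m / 2) * B
  set A₂ := (a - 1) * (a * A + B) + a * B
  set B₂ := (a - 1) * (a * B)
  have h1 := tendsto_integral_regularized hm ha' (A := A₁) (B := B₁)
    (fun _ => logPow (a - 1) A₁ B₁) (logPow (a - 1) A₁ B₁) (fun _ _ => continuousOn_logPow _ _ _)
    (fun _ _ _ _ => le_rfl) (fun t ht => tendsto_logPow_add _ _ _ ht) φ.continuous
    φ.hasCompactSupport
  -- The error tends to 0 pointwise, and ε ≤ w bounds it by a function with the locally integrable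
  -- exponent a - 1.
  have h2 := tendsto_integral_regularized hm ha' (A := A₂) (B := B₂)
    (fun ε w => ε * logPow (a - 1 - 1) A₂ B₂ w) (fun _ => 0)
    (fun _ _ => continuousOn_const.mul (continuousOn_logPow _ _ _))
    (fun ε w hε hw => ?_) (fun t ht => ?_) φ.continuous φ.hasCompactSupport
  · refine (Tendsto.congr' ?_ (h1.sub (h2.const_mul 4)).neg).trans_eq ?_
    · filter_upwards [self_mem_nhdsWithin] with ε hε
      have hε : 0 < ε := hε
      rw [← integral_const_mul, ← integral_sub (integrable_mul_logPow_add _ _ _ φ hε)]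
      · congr 2
        funext x
        ring
      · refine Integrable.congr ((integrable_mul_logPow_add (a - 1 - 1) A₂ B₂ φ hε).const_mul
          (4 * ε)) (Eventually.of_forall fun x => ?_)
        simp only
        ring
    · rw [toDistr_apply]
      congr 1
      simp only [mul_zero, integral_zero, sub_zero]
      rw [← integral_neg]
      congr 1
      funext x
      simp only [radialL1loc, logPow, hA, hB]
      ring
  · have hw0 : 0 < w := hε.trans_le hw
    rw [← mul_logPow (a - 1) A₂ B₂ hw0, abs_mul, abs_mul, abs_of_pos hε, abs_of_pos hw0]
    exact mul_le_mul_of_nonneg_right hw (abs_nonneg _)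
  · have h3 : Tendsto (fun ε : ℝ => ε) (𝓝[>] 0) (𝓝 0) :=
      tendsto_nhdsWithin_of_tendsto_nhds tendsto_id
    simpa using h3.mul (tendsto_logPow_add (a - 1 - 1) A₂ B₂ ht)

/-- The fundamental solution of the Laplace operator. -/
theorem bLaplace_radial_eq_delta (hm : m ≠ 0) {a A B : ℝ} (ha : -(m / 2 : ℝ) < a)
    (ham : a = 1 - m / 2) (hB : a * B = 0) (hAB : a * A + B = -(2 * m * ballVol m)⁻¹) :
    bLaplace m (toDistr m (radialL1loc hm ha A B)) = Distribution.delta 0 := by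
  have hV := (ballVol_pos (m := m)).ne'
  have hm' : (m : ℝ) ≠ 0 := by exact_mod_cast hm
  ext φ
  refine tendsto_nhds_unique (bLaplace_radial_tendsto hm ha A B φ) ?_
  have h := (tendsto_integral_kernel hm φ.continuous φ.hasCompactSupport).const_mul (ballVol m)⁻¹
  rw [inv_mul_cancel_left₀ hV] at h
  refine h.congr' ?_
  filter_upwards [self_mem_nhdsWithin] with ε hε
  rw [← integral_const_mul, ← integral_neg]
  congr 1
  funext x
  -- At the critical exponent the classical term vanishes, as aB = 0 (either B = 0, or a = 0 and m =
  -- 2). What remains is the kernel with constant 4 · (-m/2) · (-(2m · `ballVol m`)⁻¹) = (`ballVol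
  -- m`)⁻¹.
  have e1 : a - 1 + m / 2 = 0 := by rw [ham]; ring
  have e2 : 8 * a - 4 + 2 * m = 4 * a := by rw [ham]; ring
  have e3 : a - 1 - 1 = -((m : ℝ) + 2) / 2 := by rw [ham]; ring
  have e4 : a - 1 = -(m / 2 : ℝ) := by rw [ham]; ring
  rw [e1, e2, e3, hB, hAB, e4]
  simp only [logPow]
  rw [mul_assoc 4 a B, hB]
  field_simp
  ring

end RadialDistr

/-! ### The polyharmonic sequence -/

section Sequence

open Filter Set Topology

variable {m : ℕ}

/-- The exponent of `‖x‖ ^ 2` in the `l + 1`-st function of the polyharmonic sequence. -/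
noncomputable def polyExp (m l : ℕ) : ℝ := l + 1 - m / 2

theorem neg_lt_polyExp (m l : ℕ) : -(m / 2 : ℝ) < polyExp m l := by
  have : (0 : ℝ) ≤ l := l.cast_nonneg
  rw [polyExp]
  linarith

theorem polyExp_succ (m l : ℕ) : polyExp m (l + 1) = polyExp m l + 1 := by
  simp [polyExp]; ring

open Classical in
/-- The coefficients of `‖x‖ ^ (2 * a)` and `‖x‖ ^ (2 * a) * log (‖x‖ ^ 2)`, `a = polyExp m l`, in
the `l + 1`-st function of the polyharmonic sequence. -/
noncomputable def polyCoeff (m : ℕ) : ℕ → ℝ × ℝ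
  | 0 => if polyExp m 0 = 0 then (0, -(2 * m * ballVol m)⁻¹)
      else (-(2 * m * ballVol m)⁻¹ / polyExp m 0, 0)
  | l + 1 =>
    let p := polyCoeff m l
    let a := polyExp m (l + 1)
    if a = 0 then (0, -p.1 / (4 * (l + 1)))
    else
      let B := -p.2 / (4 * a * (l + 1))
      (-(p.1 + (8 * a - 4 + 2 * m) * B) / (4 * a * (l + 1)), B)

theorem polyCoeff_zero_snd : polyExp m 0 * (polyCoeff m 0).2 = 0 := by
  rw [polyCoeff]
  split_ifs with h <;> simp [h]

theorem polyCoeff_zero : polyExp m 0 * (polyCoeff m 0).1 + (polyCoeff m 0).2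
    = -(2 * m * ballVol m)⁻¹ := by
  rw [polyCoeff]
  split_ifs with h
  · simp
  · rw [mul_div_cancel₀ _ h, add_zero]

/-- The exponents increase with l, so none has been 0 before a negative one, and only a zero
exponent introduces a logarithm. -/
theorem polyCoeff_snd_eq_zero (l : ℕ) (h : polyExp m l < 0) : (polyCoeff m l).2 = 0 := by
  induction l with
  | zero => rw [polyCoeff, if_neg h.ne]
  | succ l ih =>
    rw [polyCoeff]
    simp only [if_neg h.ne]
    rw [ih (by rw [polyExp_succ] at h; linarith), neg_zero, zero_div]

theorem polyExp_sub_one_add (m l : ℕ) : polyExp m (l + 1) - 1 + m / 2 = l + 1 := by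
  rw [polyExp]; push_cast; ring

/-- At a zero exponent the right-hand side vanishes; the previous exponent is then -1, where there
is no logarithm yet. -/
theorem polyCoeff_succ_snd (l : ℕ) :
    (polyCoeff m l).2 = -(4 * polyExp m (l + 1) * (l + 1) * (polyCoeff m (l + 1)).2) := by
  have hl : (l + 1 : ℝ) ≠ 0 := by positivity
  rw [polyCoeff]
  by_cases h : polyExp m (l + 1) = 0
  · rw [polyCoeff_snd_eq_zero l (by rw [polyExp_succ] at h; linarith), h]
    simp
  · simp only [if_neg h]
    field_simp

/-- At a zero exponent the pure power is constant and contributes nothing; the logarithm must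
produce the previous term, and its factor 8a - 4 + 2m equals 4(l+1). -/
theorem polyCoeff_succ_fst (l : ℕ) :
    (polyCoeff m l).1 = -(4 * polyExp m (l + 1) * (l + 1) * (polyCoeff m (l + 1)).1
      + (8 * polyExp m (l + 1) - 4 + 2 * m) * (polyCoeff m (l + 1)).2) := by
  have hl : (l + 1 : ℝ) ≠ 0 := by positivity
  rw [polyCoeff]
  by_cases h : polyExp m (l + 1) = 0
  · have e : 8 * polyExp m (l + 1) - 4 + 2 * m = 4 * (l + 1) := by
      linear_combination 4 * polyExp_sub_one_add m l + 4 * h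
    rw [e]
    simp only [if_pos h]
    field_simp
    ring
  · simp only [if_neg h]
    field_simp
    ring

/-- A sequence of polyharmonic fundamental solutions; the value at `0` is not used. -/
noncomputable def polySeq (hm : m ≠ 0) : ℕ → L1loc m
  | 0 => 0
  | l + 1 => radialL1loc hm (neg_lt_polyExp m l) (polyCoeff m l).1 (polyCoeff m l).2

theorem bLaplace_polySeq_one (hm : m ≠ 0) :
    bLaplace m (toDistr m (polySeq hm 1)) = Distribution.delta 0 :=
  bLaplace_radial_eq_delta hm (neg_lt_polyExp m 0) (by simp [polyExp]) polyCoeff_zero_snd polyCoeff_zero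

theorem bLaplace_polySeq_succ (hm : m ≠ 0) (l : ℕ) :
    bLaplace m (toDistr m (polySeq hm (l + 2))) = toDistr m (polySeq hm (l + 1)) :=
  bLaplace_radial hm (neg_lt_polyExp m (l + 1)) (neg_lt_polyExp m l) (by rw [polyExp_succ]; ring)
    (by rw [polyExp_sub_one_add]; exact polyCoeff_succ_fst l)
    (by rw [polyExp_sub_one_add]; exact polyCoeff_succ_snd l)

theorem isPolyharmonicSequence_polySeq (hm : m ≠ 0) : IsPolyharmonicSequence (polySeq hm) := by
  -- Indexing from the lower end l + 1 avoids truncated subtraction in the induction.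
  have h (l j : ℕ) : (bLaplace m ^ j) (toDistr m (polySeq hm (l + 1 + j)))
      = toDistr m (polySeq hm (l + 1)) := by
    induction j with
    | zero => rfl
    | succ j ih =>
      rw [pow_succ, Module.End.mul_apply, show l + 1 + (j + 1) = l + j + 2 by omega,
        bLaplace_polySeq_succ, show l + j + 1 = l + 1 + j by omega, ih]
  intro l hl
  refine ⟨fun j hj => ?_, ?_⟩
  · have := h (l - j - 1) j
    rwa [show l - j - 1 + 1 + j = l by omega, show l - j - 1 + 1 = l - j by omega] at this
  · have := h 0 (l - 1)
    rw [show 0 + 1 + (l - 1) = l by omega, zero_add] at this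
    obtain ⟨k, rfl⟩ : ∃ k, l = k + 1 := ⟨l - 1, by omega⟩
    rw [pow_succ', Module.End.mul_apply]
    rw [Nat.add_sub_cancel] at this
    rw [this, bLaplace_polySeq_one]

theorem polyExp_ne_zero_of_odd (hm : Odd m) (l : ℕ) : polyExp m l ≠ 0 := by
  intro h
  have h2 : (m : ℝ) = 2 * (l + 1) := by rw [polyExp] at h; linarith
  have h3 : m = 2 * (l + 1) := by exact_mod_cast h2
  exact (Nat.not_even_iff_odd.2 hm) ⟨l + 1, by omega⟩

theorem polyCoeff_snd_of_odd (hm : Odd m) (l : ℕ) : (polyCoeff m l).2 = 0 := by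
  induction l with
  | zero => rw [polyCoeff, if_neg (polyExp_ne_zero_of_odd hm 0)]
  | succ l ih =>
    rw [polyCoeff]
    simp only [if_neg (polyExp_ne_zero_of_odd hm (l + 1))]
    rw [ih, neg_zero, zero_div]

theorem Gamma_ne_zero_of_odd (hm : Odd m) (l : ℕ) : Real.Gamma (l + 2 - m / 2 : ℝ) ≠ 0 := by
  refine Real.Gamma_ne_zero fun k hk => ?_
  have h2 : (m : ℝ) = 2 * (l + 2 + k) := by linarith
  have h3 : m = 2 * (l + 2 + k) := by exact_mod_cast h2
  exact (Nat.not_even_iff_odd.2 hm) ⟨l + 2 + k, by omega⟩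

/-- The sphere area 2π^(m/2)/Γ(m/2) is m · `ballVol m`, and 2 - m is twice the first exponent.
Oddness keeps Γ(2 - m/2) nonzero, so the Gamma quotient is 1. -/
theorem gammaConst_zero_of_odd (hm : Odd m) :
    gammaConst m 0 = -(2 * m * ballVol m * polyExp m 0) := by
  have h := Gamma_ne_zero_of_odd hm 0
  have hm0 : m ≠ 0 := by rintro rfl; simp at hm
  have hm' : (m / 2 : ℝ) ≠ 0 := by positivity
  have hG : Real.Gamma (m / 2 : ℝ) ≠ 0 := (Real.Gamma_pos_of_pos (by positivity)).ne'
  rw [gammaConst, ballVol_eq hm0, Real.Gamma_add_one hm', polyExp]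
  simp only [Nat.cast_zero, zero_add] at h ⊢
  rw [div_self h]
  simp
  field_simp
  ring

/-- The functional equation of Γ supplies the factor l + 2 - m/2, which is the next exponent; thus γ
obeys the recursion of the inverse coefficients. -/
theorem gammaConst_succ_of_odd (hm : Odd m) (l : ℕ) :
    gammaConst m (l + 1) = -(4 * polyExp m (l + 1) * (l + 1)) * gammaConst m l := by
  have h : (l + 2 - m / 2 : ℝ) ≠ 0 := by
    have := polyExp_ne_zero_of_odd hm (l + 1)
    rw [polyExp] at this
    push_cast at this
    convert this using 1
    ring
  have e : Real.Gamma (((l + 1 : ℕ) : ℝ) + 2 - m / 2)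
      = (l + 2 - m / 2 : ℝ) * Real.Gamma (l + 2 - m / 2 : ℝ) := by
    rw [← Real.Gamma_add_one h]
    congr 1
    push_cast
    ring
  rw [gammaConst, gammaConst, e, Nat.factorial_succ, polyExp]
  push_cast
  ring

theorem polyCoeff_fst_of_odd (hm : Odd m) (l : ℕ) : (polyCoeff m l).1 = (gammaConst m l)⁻¹ := by
  induction l with
  | zero =>
    have h := @polyCoeff_zero m
    rw [polyCoeff_snd_of_odd hm, add_zero] at h
    rw [gammaConst_zero_of_odd hm, inv_neg, mul_inv, neg_mul_eq_neg_mul, ← h]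
    field_simp [polyExp_ne_zero_of_odd hm 0]
  | succ l ih =>
    have hl : (l + 1 : ℝ) ≠ 0 := by positivity
    have h := @polyCoeff_succ_fst m l
    rw [polyCoeff_snd_of_odd hm, mul_zero, add_zero, ih] at h
    rw [gammaConst_succ_of_odd hm, mul_inv, h]
    field_simp [polyExp_ne_zero_of_odd hm (l + 1)]

theorem polySeq_of_odd (hm0 : m ≠ 0) (hm : Odd m) (l : ℕ) (x : E m) :
    (polySeq hm0 (l + 1) : E m → ℝ) x
      = ‖x‖ ^ (2 * ((l : ℤ) + 1) - (m : ℤ)) / gammaConst m l := by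
  have e : (‖x‖ ^ 2) ^ polyExp m l = ‖x‖ ^ (2 * ((l : ℤ) + 1) - (m : ℤ)) := by
    rw [← Real.rpow_natCast_mul (norm_nonneg x), ← Real.rpow_intCast, polyExp]
    congr 1
    push_cast
    ring
  simp only [polySeq, radialL1loc, logPow, polyCoeff_snd_of_odd hm, polyCoeff_fst_of_odd hm, e]
  ring

end Sequence

/-! ### The two parts combined -/

theorem theorem4 (m n : ℕ) (hm : m ≠ 0) :
    (∃ ν : ℕ → L1loc m, IsPolyharmonicSequence ν ∧
      (Odd m → ∀ (l : ℕ) (x : E m),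
        (ν (l + 1) : E m → ℝ) x = ‖x‖ ^ (2 * ((l : ℤ) + 1) - (m : ℤ)) / gammaConst m l)) ∧
    ∀ ν : ℕ → L1loc m, IsPolyharmonicSequence ν → ∀ k : ℕ, 1 ≤ k →
      (superLaplace m n ^ k) (toSuperDistr m n (superNu n ν k)) = superDelta m n := by
  refine ⟨⟨polySeq hm, isPolyharmonicSequence_polySeq hm, fun h => polySeq_of_odd hm h⟩,
    fun ν hν k hk => ?_⟩
  obtain ⟨k, rfl⟩ : ∃ j, k = j + 1 := ⟨k - 1, by omega⟩
  exact superLaplace_pow_superNu hν k
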